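/- Graphs are finite and may have loops and multiple edges; a loop contributes 2 to the degree of its vertex. An edge cut of a graph $G$ is the set of edges with exactly one end in $A$, for some set $A$ with $\emptyset\neq A\subsetneq V(G)$. The graph $G$ is $m$-edge-connected if each of its edge cuts has at least $m$ edges, and essentially $\lambda$-edge-connected if, for every edge cut with strictly fewer than $\lambda$ edges, all edges of the cut are incident with a common vertex. A factor of $G$ is a spanning subgraph of $G$. Theorem. Let $k$ be a positive integer and let $G$ be a graph with an even number of vertices. (1) If $G$ is $(10k-3)$-edge-connected and essentially $(12k-7)$-edge-connected, then $G$ has a factor $H$ such that for every vertex $v$ the degree $d_H(v)$ is positive, divisible by $k$, and not divisible by $2k$. (2) The same conclusion holds if $G$ is bipartite, $(5k-1)$-edge-connected and essentially $(6k-3)$-edge-connected. -/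

import Mathlib

open scoped Graph

namespace Graph

/-- The edges of `G` with exactly one end in `A`, for `A` a set of vertices of `G`. -/
def edgeCut {α β : Type*} (G : Graph α β) (A : Set α) : Set β :=
  {e | ∃ x ∈ A, ∃ y ∉ A, G.IsLink e x y}

/-- The degree `d_G(v)` in a finite multigraph: the number of edges incident with `v`, where every
loop at `v` is counted twice. -/
noncomputable def degree {α β : Type*} (G : Graph α β) (v : α) : ℕ :=
  (G.incidenceSet v).ncard + (G.loopSet v).ncard

/-- A finite multigraph is `m`-edge-connected if each of its edge cuts has at least `m` edges. -/
def IsEdgeConnected {α β : Type*} (G : Graph α β) (m : ℕ) : Prop :=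
  ∀ A : Set α, A.Nonempty → A ⊂ V(G) → m ≤ (G.edgeCut A).ncard

/-- A finite multigraph is essentially `l`-edge-connected if for each of its edge cuts with fewer
than `l` edges, all edges of the cut are incident with a common vertex. -/
def IsEssentiallyEdgeConnected {α β : Type*} (G : Graph α β) (l : ℕ) : Prop :=
  ∀ A : Set α, A.Nonempty → A ⊂ V(G) → (G.edgeCut A).ncard < l →
    ∃ v ∈ V(G), ∀ e ∈ G.edgeCut A, G.Inc e v

/-- The vertex set splits into two disjoint (possibly empty) parts `X`, `Y` such that every edge
joins a vertex of `X` to a vertex of `Y`. -/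
def IsBipartite {α β : Type*} (G : Graph α β) : Prop :=
  ∃ X Y : Set α, Disjoint X Y ∧ X ∪ Y = V(G) ∧
    ∀ e ∈ E(G), ∃ x ∈ X, ∃ y ∈ Y, G.IsLink e x y

/-- A modulo `k`-regular graph: all degrees are positive and divisible by `k`. -/
def IsModuloRegular {α β : Type*} (G : Graph α β) (k : ℕ) : Prop :=
  ∀ v ∈ V(G), 0 < G.degree v ∧ k ∣ G.degree v

end Graph

/-! In a bipartite graph with classes `X` and `Y`, a factor is the same thing as an orientation: its
edges are those directed from `X` to `Y`. Up to sign, twice the factor degree at a vertex is the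
excess of out-degree over in-degree plus a fixed number. So degrees congruent to `k` modulo `2k`
amount to prescribed excesses `b` modulo `4k = 2m`, where `m = 2k`.

Such orientations come from `Good.solvable`. They exist if every vertex set `A` has a cut of size at
least `2m - 2` plus the distance of `b(A)` from zero modulo `2m`. For the induction the statement
also admits a special vertex whose edges are already directed, of degree at most the corresponding
bound, and one exempt vertex of residue zero. A nontrivial set attaining its bound is contracted;
after the contraction is solved, the boundary of the set is directed and the inside is solved with
the outside as special vertex. If no such set exists, parity gives every nontrivial set two units of
slack, which pays for local reductions. Edges are lifted at a vertex that is exempt or not tight. If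
all vertices are tight and none has residue zero, an edge or arc is deleted in a direction that
brings residues nearer to zero.

For the application, cuts of size at least `6k - 3` satisfy the bound by parity alone. A smaller cut
has all its edges at one vertex, hence all are directed from `X` to `Y` across it in the same sense;
its residue is then known, and `5k - 1` edges suffice (`circDist_two_mul_mul_add_le`). The general
case follows from the bipartite one, because a maximum cut of `G` contains at least half of every
edge cut (`exists_edgeCut_half`). -/

set_option linter.unusedSectionVars false

/-! ### Distance to zero modulo `2m` -/

/-- The distance from `x` to the nearest multiple of `2 * m`. -/
def circDist (m x : ℤ) : ℤ := min (x % (2 * m)) (2 * m - x % (2 * m))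

section CircDist

variable {m x y : ℤ}

lemma exists_abs_eq_circDist (hm : 0 < m) (x : ℤ) :
    ∃ r, 2 * m ∣ x - r ∧ |r| = circDist m x ∧ -m < r ∧ r ≤ m := by
  have h0 := Int.emod_nonneg x (show 2 * m ≠ 0 by omega)
  have h1 := Int.emod_lt_of_pos x (show 0 < 2 * m by omega)
  have h3 : 2 * m ∣ x - x % (2 * m) := Int.dvd_self_sub_emod
  rcases le_or_gt (x % (2 * m)) m with h | h
  · refine ⟨x % (2 * m), h3, ?_, by omega, h⟩
    rw [circDist, abs_of_nonneg h0, min_eq_left (by omega)]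
  · refine ⟨x % (2 * m) - 2 * m, ?_, ?_, by omega, by omega⟩
    · have : x - (x % (2 * m) - 2 * m) = (x - x % (2 * m)) + 2 * m := by ring
      rw [this]
      exact dvd_add h3 dvd_rfl
    · rw [circDist, abs_of_neg (by omega), min_eq_right (by omega)]
      ring

lemma circDist_congr (h : 2 * m ∣ x - y) : circDist m x = circDist m y := by
  rw [circDist, circDist, (Int.emod_emod_of_dvd x dvd_rfl).symm,
    Int.emod_eq_emod_iff_emod_sub_eq_zero.2 (Int.emod_eq_zero_of_dvd h)]
  simp

lemma circDist_eq_abs (hm : 0 < m) (h : |x| ≤ m) : circDist m x = |x| := by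
  rw [circDist]
  rcases le_or_gt 0 x with h0 | h0
  · rw [abs_of_nonneg h0] at *
    rw [Int.emod_eq_of_lt h0 (by omega)]
    omega
  · rw [abs_of_neg h0] at *
    have : x % (2 * m) = x + 2 * m := by
      rw [← Int.add_emod_right, Int.emod_eq_of_lt (by omega) (by omega)]
    rw [this]
    omega

lemma circDist_le (hm : 0 < m) (x : ℤ) : circDist m x ≤ m := by
  obtain ⟨r, -, h, h1, h2⟩ := exists_abs_eq_circDist hm x
  rw [← h, abs_le]
  omega

lemma circDist_nonneg (hm : 0 < m) (x : ℤ) : 0 ≤ circDist m x := by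
  obtain ⟨r, -, h, h1, h2⟩ := exists_abs_eq_circDist hm x
  rw [← h]
  positivity

lemma circDist_le_abs (hm : 0 < m) (x : ℤ) : circDist m x ≤ |x| := by
  rcases le_or_gt |x| m with h | h
  · rw [circDist_eq_abs hm h]
  · exact (circDist_le hm x).trans h.le

lemma circDist_add_le (hm : 0 < m) (x y : ℤ) :
    circDist m (x + y) ≤ circDist m x + circDist m y := by
  obtain ⟨r, h, h', -⟩ := exists_abs_eq_circDist hm x
  obtain ⟨q, g, g', -⟩ := exists_abs_eq_circDist hm y
  have : 2 * m ∣ (x + y) - (r + q) := by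
    have := dvd_add h g
    rwa [show x - r + (y - q) = (x + y) - (r + q) by ring] at this
  rw [circDist_congr this, ← h', ← g']
  exact (circDist_le_abs hm _).trans (abs_add_le r q)

lemma circDist_add_abs_le (hm : 0 < m) (x y : ℤ) :
    circDist m (x + y) ≤ circDist m x + |y| := by
  have := circDist_add_le hm x y
  have := circDist_le_abs hm y
  omega

lemma circDist_neg (hm : 0 < m) (x : ℤ) : circDist m (-x) = circDist m x := by
  have key : ∀ x, circDist m (-x) ≤ circDist m x := by
    intro x
    obtain ⟨r, h, h', -⟩ := exists_abs_eq_circDist hm x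
    have : 2 * m ∣ -x - -r := by
      have := dvd_neg.2 h
      rwa [show -(x - r) = -x - -r by ring] at this
    rw [circDist_congr this, ← h', ← abs_neg r]
    exact circDist_le_abs hm _
  have := key (-x)
  rw [neg_neg] at this
  exact le_antisymm (key x) this

lemma two_dvd_circDist_sub (hm : 0 < m) (x : ℤ) : 2 ∣ circDist m x - x := by
  obtain ⟨r, ⟨c, hc⟩, h2, -⟩ := exists_abs_eq_circDist hm x
  rw [← h2]
  have h3 : x = r + 2 * (m * c) := by linarith
  rcases abs_cases r with ⟨h, -⟩ | ⟨h, -⟩ <;> omega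

/-- A nonzero residue can be moved towards zero in one of the two directions. -/
lemma circDist_step (hm : 0 < m) (h : ¬ 2 * m ∣ x) :
    circDist m (x - 1) = circDist m x - 1 ∨ circDist m (x + 1) = circDist m x - 1 := by
  obtain ⟨r, h1, h2, h3, h4⟩ := exists_abs_eq_circDist hm x
  have hr : r ≠ 0 := by
    rintro rfl
    exact h (by simpa using h1)
  rcases lt_or_gt_of_ne hr with hr | hr
  · right
    rw [circDist_congr (y := r + 1) (by simpa using h1), ← h2,
      circDist_eq_abs hm (by rw [abs_le]; omega), abs_of_nonpos (by omega), abs_of_neg hr]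
    ring
  · left
    rw [circDist_congr (y := r - 1) (by simpa using h1), ← h2,
      circDist_eq_abs hm (by rw [abs_le]; omega), abs_of_nonneg (by omega), abs_of_pos hr]

/-- A residue that decreases towards zero is represented by its distance from zero. -/
lemma dvd_sub_circDist (hm : 0 < m) (h : circDist m (x - 1) = circDist m x - 1) :
    2 * m ∣ x - circDist m x := by
  obtain ⟨r, h1, h2, h3, h4⟩ := exists_abs_eq_circDist hm x
  rcases le_or_gt 0 r with hr | hr
  · rwa [← h2, abs_of_nonneg hr]
  · exfalso
    rw [circDist_congr (y := r - 1) (by simpa using h1), ← h2,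
      circDist_eq_abs hm (by rw [abs_le]; omega), abs_of_neg (by omega), abs_of_neg hr] at h
    omega

/-- Every residue of the right parity is attained by an integer in `[-p, p]` if `m - 1 ≤ p`. -/
lemma exists_abs_le_dvd_sub {p : ℤ} (hm : 0 < m) (hp : m - 1 ≤ p) (h : 2 ∣ p - x) :
    ∃ r, |r| ≤ p ∧ 2 ∣ p - r ∧ 2 * m ∣ x - r := by
  obtain ⟨r, h1, h2, h3, h4⟩ := exists_abs_eq_circDist hm x
  have h5 : 2 ∣ x - r := (dvd_mul_right 2 m).trans h1
  refine ⟨r, ?_, by omega, h1⟩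
  rw [abs_le]
  omega

end CircDist

/-! ### Indicators of cuts and excesses -/

/-- Whether exactly one of the vertices `x`, `y` lies in `A`. -/
def sepInd {V : Type*} [DecidableEq V] (x y : V) (A : Finset V) : ℤ :=
  if (x ∈ A ↔ y ∈ A) then 0 else 1

/-- The contribution of an arc from `x` to `y` to the excess of out-degree over in-degree at `v`. -/
def incInd {V : Type*} [DecidableEq V] (x y v : V) : ℤ :=
  (if x = v then 1 else 0) - (if y = v then 1 else 0)

section Indicators

variable {V : Type*} [DecidableEq V] {x y v : V} {A : Finset V}

lemma sepInd_nonneg (x y : V) (A : Finset V) : 0 ≤ sepInd x y A := by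
  unfold sepInd
  split_ifs <;> norm_num

lemma sepInd_self (x : V) (A : Finset V) : sepInd x x A = 0 := by simp [sepInd]

lemma sepInd_comm (x y : V) (A : Finset V) : sepInd x y A = sepInd y x A := by
  simp only [sepInd, iff_comm]

lemma incInd_self (x v : V) : incInd x x v = 0 := by simp [incInd]

lemma incInd_swap (x y v : V) : incInd x y v = - incInd y x v := by simp [incInd]

lemma sum_incInd (x y : V) (A : Finset V) :
    ∑ v ∈ A, incInd x y v = (if x ∈ A then 1 else 0) - (if y ∈ A then 1 else 0) := by
  simp [incInd, Finset.sum_sub_distrib]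

lemma abs_incInd (x y v : V) : |incInd x y v| = sepInd x y {v} := by
  simp only [incInd, sepInd, Finset.mem_singleton]
  by_cases h : x = v <;> by_cases h' : y = v <;> simp [h, h']

lemma sum_eq_of_eq_off {E : Type*} [Fintype E] {F G : E → ℤ} (e : E)
    (h : ∀ f, f ≠ e → F f = G f) : ∑ f, F f = ∑ f, G f - G e + F e := by
  classical
  rw [← Finset.add_sum_erase _ F (Finset.mem_univ e),
    ← Finset.add_sum_erase _ G (Finset.mem_univ e),
    Finset.sum_congr rfl fun f hf ↦ h f (Finset.ne_of_mem_erase hf)]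
  ring

/-- A sum of signs, weighted by `0`, `1`, `-1`, takes all values allowed by size and parity. -/
lemma exists_sign_sum {E : Type*} [DecidableEq E] (ε : E → ℤ) (hε : ∀ e, |ε e| ≤ 1)
    (T : Finset E) : ∀ r : ℤ, |r| ≤ ∑ e ∈ T, |ε e| → 2 ∣ ∑ e ∈ T, |ε e| - r →
      ∃ σ : E → ℤ, (∀ e, σ e = 1 ∨ σ e = -1) ∧ ∑ e ∈ T, σ e * ε e = r := by
  induction T using Finset.induction_on with
  | empty =>
    intro r hr _
    refine ⟨fun _ ↦ 1, fun _ ↦ Or.inl rfl, ?_⟩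
    simp only [Finset.sum_empty, abs_nonpos_iff] at hr ⊢
    exact hr.symm
  | insert e T he ih =>
    intro r hr h2
    rw [Finset.sum_insert he] at hr h2
    -- Fix the sign `δ` of `e` and leave the rest to the induction hypothesis; below, `δ` is chosen
    -- so that the remaining target moves towards zero.
    have main : ∀ δ : ℤ, (δ = 1 ∨ δ = -1) → |r - δ * ε e| ≤ ∑ e ∈ T, |ε e| →
        ∃ σ : E → ℤ, (∀ e, σ e = 1 ∨ σ e = -1) ∧ ∑ e ∈ insert e T, σ e * ε e = r := by
      intro δ hδ h
      obtain ⟨σ, hσ, hs⟩ := ih (r - δ * ε e) h (by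
        rcases hδ with rfl | rfl <;> rcases abs_cases (ε e) with ⟨h, -⟩ | ⟨h, -⟩ <;> omega)
      refine ⟨Function.update σ e δ, fun f ↦ ?_, ?_⟩
      · by_cases hf : f = e
        · simpa [hf] using hδ
        · simpa [hf] using hσ f
      · rw [Finset.sum_insert he, Finset.sum_congr rfl (g := fun f ↦ σ f * ε f), hs]
        · simp
        · intro f hf
          rw [Function.update_of_ne (ne_of_mem_of_not_mem hf he)]
    have h1 := abs_le.1 (hε e)
    have h0 : ε e = 0 ∨ ε e = 1 ∨ ε e = -1 := by omega
    have hr' := abs_le.1 hr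
    have hT : 0 ≤ ∑ e ∈ T, |ε e| := Finset.sum_nonneg fun _ _ ↦ abs_nonneg _
    rcases h0 with h0 | h0 | h0 <;> rw [h0] at hr hr' h2 main
    · exact main 1 (Or.inl rfl) (by simpa using hr)
    · rcases le_or_gt r 0 with h | h
      · exact main (-1) (Or.inr rfl) (by rw [abs_le]; simp only [abs_one] at *; omega)
      · exact main 1 (Or.inl rfl) (by rw [abs_le]; simp only [abs_one] at *; omega)
    · rcases le_or_gt r 0 with h | h
      · exact main 1 (Or.inl rfl) (by rw [abs_le]; simp only [abs_one, abs_neg] at *; omega)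
      · exact main (-1) (Or.inr rfl) (by rw [abs_le]; simp only [abs_one, abs_neg] at *; omega)

end Indicators

/-! ### Partially directed multigraphs and the cut condition -/

/-- A multigraph on `S` with edges `e` joining `s e` to `t e` (loops are ignored), together with a
further vertex whose incident edges are already directed: at `v` there are `o v` arcs towards it
and `i v` arcs from it. The required excess of out-degree over in-degree at `v` is `b v`. -/
structure OrState (V E : Type*) where
  /-- the vertices -/
  S : Finset V
  /-- the first ends of the edges -/
  s : E → V
  /-- the second ends of the edges -/
  t : E → V
  /-- the numbers of arcs to the special vertex -/
  o : V → ℤ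
  /-- the numbers of arcs from the special vertex -/
  i : V → ℤ
  /-- the required excesses -/
  b : V → ℤ

namespace OrState

variable {V E : Type*} [DecidableEq V] [Fintype E] {Q : OrState V E} {m : ℤ} {v0 : V}

/-- The number of edges leaving `A`. -/
def cut (Q : OrState V E) (A : Finset V) : ℤ :=
  ∑ e, sepInd (Q.s e) (Q.t e) A + ∑ v ∈ A, (Q.o v + Q.i v)

/-- The excess at `v` of the orientation with signs `σ`. -/
def exc (Q : OrState V E) (σ : E → ℤ) (v : V) : ℤ :=
  ∑ e, σ e * incInd (Q.s e) (Q.t e) v + Q.o v - Q.i v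

/-- There is an orientation with the required excesses modulo `2 * m`. -/
def Solvable (m : ℤ) (Q : OrState V E) : Prop :=
  ∃ σ : E → ℤ, (∀ e, σ e = 1 ∨ σ e = -1) ∧ ∀ v ∈ Q.S, 2 * m ∣ Q.exc σ v - Q.b v

/-- The conditions under which an orientation exists; the set `{v0}` is exempt from the condition
on cuts if the required excess at `v0` is zero. -/
structure Good (m : ℤ) (v0 : V) (Q : OrState V E) : Prop where
  two : 2 ≤ Q.S.card
  ends : ∀ e, Q.s e ≠ Q.t e → Q.s e ∈ Q.S ∧ Q.t e ∈ Q.S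
  o_nonneg : ∀ v, 0 ≤ Q.o v
  i_nonneg : ∀ v, 0 ≤ Q.i v
  total : 2 * m ∣ ∑ v ∈ Q.S, (Q.o v - Q.i v) - ∑ v ∈ Q.S, Q.b v
  parity : ∀ v ∈ Q.S, 2 ∣ Q.exc (fun _ ↦ 1) v - Q.b v
  -- An upper bound of the same form as the lower bound on cuts, so that the outside of a set
  -- attaining its bound can serve as special vertex.
  special : ∑ v ∈ Q.S, (Q.o v + Q.i v) ≤ 2 * m - 2 + circDist m (∑ v ∈ Q.S, Q.b v)
  le_cut : ∀ A ⊆ Q.S, A.Nonempty → A ≠ Q.S → ¬ (A = {v0} ∧ 2 * m ∣ Q.b v0) →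
    2 * m - 2 + circDist m (∑ v ∈ A, Q.b v) ≤ Q.cut A

lemma sum_exc (Q : OrState V E) (σ : E → ℤ) (A : Finset V) :
    ∑ v ∈ A, Q.exc σ v = ∑ e, σ e * ((if Q.s e ∈ A then 1 else 0) - (if Q.t e ∈ A then 1 else 0)) +
      ∑ v ∈ A, (Q.o v - Q.i v) := by
  simp only [exc, add_sub_assoc, Finset.sum_add_distrib]
  rw [Finset.sum_comm]
  simp_rw [← Finset.mul_sum, sum_incInd]

/-- Edges inside `A` contribute nothing to either side, and an edge or arc leaving `A` contributes
one to the cut and plus or minus one to the excess. -/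
lemma two_dvd_cut_sub_sum_exc (Q : OrState V E) (A : Finset V) :
    2 ∣ Q.cut A - ∑ v ∈ A, Q.exc (fun _ ↦ 1) v := by
  rw [sum_exc, cut, show ∀ a b c d : ℤ, a + b - (c + d) = (a - c) + (b - d) by intros; ring,
    ← Finset.sum_sub_distrib, ← Finset.sum_sub_distrib]
  refine dvd_add (Finset.dvd_sum fun e _ ↦ ?_) (Finset.dvd_sum fun v _ ↦ ?_)
  · simp only [sepInd]
    by_cases h : Q.s e ∈ A <;> by_cases h' : Q.t e ∈ A <;> simp [h, h']
  · exact ⟨Q.i v, by ring⟩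

lemma Good.two_dvd_cut_sub (h : Q.Good m v0) {A : Finset V} (hA : A ⊆ Q.S) :
    2 ∣ Q.cut A - ∑ v ∈ A, Q.b v := by
  have h1 := Q.two_dvd_cut_sub_sum_exc A
  have h2 : 2 ∣ ∑ v ∈ A, Q.exc (fun _ ↦ 1) v - ∑ v ∈ A, Q.b v := by
    rw [← Finset.sum_sub_distrib]
    exact Finset.dvd_sum fun v hv ↦ h.parity v (hA hv)
  omega

/-- By parity, a cut that exceeds its lower bound exceeds it by at least two. -/
lemma Good.cut_eq_or_le (h : Q.Good m v0) (hm : 0 < m) {A : Finset V} (hA : A ⊆ Q.S)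
    (hc : 2 * m - 2 + circDist m (∑ v ∈ A, Q.b v) ≤ Q.cut A) :
    Q.cut A = 2 * m - 2 + circDist m (∑ v ∈ A, Q.b v) ∨
      2 * m + circDist m (∑ v ∈ A, Q.b v) ≤ Q.cut A := by
  have h1 := h.two_dvd_cut_sub hA
  have h2 := two_dvd_circDist_sub hm (∑ v ∈ A, Q.b v)
  omega

/-- Edges between `A` and its complement are counted twice, arcs at the special vertex once.
Together with `special`, this forces edges to exist wherever both cuts are large. -/
lemma Good.cut_add_cut_sdiff (h : Q.Good m v0) {A : Finset V} (hA : A ⊆ Q.S) :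
    Q.cut A + Q.cut (Q.S \ A) =
      2 * ∑ e, sepInd (Q.s e) (Q.t e) A + ∑ v ∈ Q.S, (Q.o v + Q.i v) := by
  have : ∑ e, sepInd (Q.s e) (Q.t e) (Q.S \ A) = ∑ e, sepInd (Q.s e) (Q.t e) A := by
    refine Finset.sum_congr rfl fun e _ ↦ ?_
    by_cases he : Q.s e = Q.t e
    · rw [he, sepInd_self, sepInd_self]
    · have := h.ends e he
      simp only [sepInd, Finset.mem_sdiff, this.1, this.2, true_and, not_iff_not]
  rw [cut, cut, this, ← Finset.sum_sdiff hA]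
  ring

/-- The edge `e` joins the distinct vertices `x` and `y`. -/
def Joins (Q : OrState V E) (e : E) (x y : V) : Prop :=
  x ≠ y ∧ (Q.s e = x ∧ Q.t e = y ∨ Q.s e = y ∧ Q.t e = x)

lemma Joins.symm {e : E} {x y : V} (h : Q.Joins e x y) : Q.Joins e y x :=
  ⟨h.1.symm, h.2.symm⟩

lemma Joins.sepInd_eq {e : E} {x y : V} (h : Q.Joins e x y) (A : Finset V) :
    sepInd (Q.s e) (Q.t e) A = sepInd x y A := by
  rcases h.2 with ⟨h1, h2⟩ | ⟨h1, h2⟩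
  · rw [h1, h2]
  · rw [h1, h2, sepInd_comm]

lemma Joins.exists_incInd_eq {e : E} {x y : V} (h : Q.Joins e x y) :
    ∃ ε : ℤ, (ε = 1 ∨ ε = -1) ∧ ∀ v, incInd (Q.s e) (Q.t e) v = ε * incInd x y v := by
  rcases h.2 with ⟨h1, h2⟩ | ⟨h1, h2⟩
  · exact ⟨1, Or.inl rfl, fun v ↦ by rw [h1, h2, one_mul]⟩
  · exact ⟨-1, Or.inr rfl, fun v ↦ by rw [h1, h2, incInd_swap]; ring⟩

lemma Joins.ne {e : E} {x y : V} (h : Q.Joins e x y) : Q.s e ≠ Q.t e := by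
  rcases h with ⟨h, ⟨h1, h2⟩ | ⟨h1, h2⟩⟩ <;> rw [h1, h2]
  exacts [h, h.symm]

lemma Good.joins_mem (h : Q.Good m v0) {e : E} {x y : V} (he : Q.Joins e x y) :
    x ∈ Q.S ∧ y ∈ Q.S := by
  have := h.ends e he.ne
  rcases he.2 with ⟨h1, h2⟩ | ⟨h1, h2⟩ <;> rw [h1, h2] at this
  exacts [this, this.symm]

lemma exists_joins_of_sepInd_ne {e : E} {A : Finset V} (h : sepInd (Q.s e) (Q.t e) A ≠ 0) :
    ∃ x ∈ A, ∃ y ∉ A, Q.Joins e x y := by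
  simp only [sepInd] at h
  by_cases h1 : Q.s e ∈ A <;> by_cases h2 : Q.t e ∈ A <;> simp [h1, h2] at h
  · exact ⟨_, h1, _, h2, ne_of_mem_of_not_mem h1 h2, Or.inl ⟨rfl, rfl⟩⟩
  · exact ⟨_, h2, _, h1, ne_of_mem_of_not_mem h2 h1, Or.inr ⟨rfl, rfl⟩⟩

/-- The number of edges that are not loops. -/
def size (Q : OrState V E) : ℕ := (Finset.univ.filter fun e ↦ Q.s e ≠ Q.t e).card

/-- The mirror image, in which all directions are reversed. -/
def mirror (Q : OrState V E) : OrState V E :=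
  { Q with o := Q.i, i := Q.o, b := fun v ↦ - Q.b v }

lemma exc_neg (Q : OrState V E) (σ : E → ℤ) (v : V) :
    Q.exc (fun e ↦ - σ e) v = - Q.mirror.exc σ v := by
  simp only [exc, mirror, neg_mul, Finset.sum_neg_distrib]
  ring

lemma Solvable.of_mirror (h : Q.mirror.Solvable m) : Q.Solvable m := by
  obtain ⟨σ, hσ, h⟩ := h
  refine ⟨fun e ↦ - σ e, fun e ↦ ?_, fun v hv ↦ ?_⟩
  · rcases hσ e with h | h <;> simp [h]
  · have h1 := dvd_neg.2 (h v hv)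
    rw [exc_neg]
    rwa [show -(Q.mirror.exc σ v - Q.mirror.b v) = -Q.mirror.exc σ v - Q.b v by
      simp only [mirror]; ring] at h1

lemma cut_mirror (Q : OrState V E) (A : Finset V) : Q.mirror.cut A = Q.cut A := by
  simp only [cut, mirror, add_comm]

lemma Good.mirror (hm : 0 < m) (h : Q.Good m v0) : Q.mirror.Good m v0 where
  two := h.two
  ends := h.ends
  o_nonneg := h.i_nonneg
  i_nonneg := h.o_nonneg
  total := by
    have h1 := dvd_neg.2 h.total
    rwa [show -(∑ v ∈ Q.S, (Q.o v - Q.i v) - ∑ v ∈ Q.S, Q.b v) =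
      ∑ v ∈ Q.mirror.S, (Q.mirror.o v - Q.mirror.i v) - ∑ v ∈ Q.mirror.S, Q.mirror.b v by
        simp only [OrState.mirror, Finset.sum_neg_distrib, Finset.sum_sub_distrib]
        ring] at h1
  parity v hv := by
    have h1 := h.parity v hv
    simp only [exc, OrState.mirror] at h1 ⊢
    omega
  special := by
    have := h.special
    simp only [OrState.mirror, Finset.sum_neg_distrib, circDist_neg hm]
    simpa only [add_comm] using this
  le_cut A hA hne hS hex := by
    rw [cut_mirror]
    simp only [OrState.mirror, Finset.sum_neg_distrib, circDist_neg hm, dvd_neg] at hex ⊢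
    exact h.le_cut A hA hne hS hex

end OrState

/-! ### Two vertices, contraction and restriction -/

namespace OrState

variable {V E : Type*} [DecidableEq V] [Fintype E] {Q : OrState V E} {m : ℤ} {v0 : V}

lemma sum_exc_eq_of_ends (h : ∀ e, Q.s e ≠ Q.t e → Q.s e ∈ Q.S ∧ Q.t e ∈ Q.S) (σ : E → ℤ) :
    ∑ v ∈ Q.S, Q.exc σ v = ∑ v ∈ Q.S, (Q.o v - Q.i v) := by
  rw [sum_exc, Finset.sum_eq_zero, zero_add]
  intro e _
  by_cases he : Q.s e = Q.t e
  · simp [he]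
  · simp [h e he]

/-- Reversing an edge changes the excess by an even amount, so the parity condition does not depend
on the reference orientation. -/
lemma two_dvd_exc_sub {σ : E → ℤ} (hσ : ∀ e, σ e = 1 ∨ σ e = -1) (v : V) :
    2 ∣ Q.exc σ v - Q.exc (fun _ ↦ 1) v := by
  have : Q.exc σ v - Q.exc (fun _ ↦ 1) v =
      ∑ e, (σ e - 1) * incInd (Q.s e) (Q.t e) v := by
    simp only [exc, sub_mul, Finset.sum_sub_distrib]
    ring
  rw [this]
  refine Finset.dvd_sum fun e _ ↦ Dvd.dvd.mul_right ?_ _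
  rcases hσ e with h | h <;> norm_num [h]

/-- Only the `p` edges between `x` and `y` are free, and `total` settles `y` once `x` is right. The
cut conditions supply enough edges to reach the residue needed at `x`. -/
lemma Good.solvable_of_card_eq_two (hm : 0 < m) (h : Q.Good m v0) (hc : Q.S.card = 2) :
    Q.Solvable m := by
  classical
  obtain ⟨x, y, hxy, hS, hy⟩ : ∃ x y, x ≠ y ∧ Q.S = {x, y} ∧
      ¬ (({y} : Finset V) = {v0} ∧ 2 * m ∣ Q.b v0) := by
    obtain ⟨x, y, hxy, hS⟩ := Finset.card_eq_two.1 hc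
    by_cases hy : ({y} : Finset V) = {v0} ∧ 2 * m ∣ Q.b v0
    · refine ⟨y, x, hxy.symm, by rw [hS, Finset.pair_comm], fun hx ↦ hxy ?_⟩
      exact (Finset.singleton_inj.1 hx.1).trans (Finset.singleton_inj.1 hy.1).symm
    · exact ⟨x, y, hxy, hS, hy⟩
  have hxS : {x} ⊆ Q.S := by simp [hS]
  have hyS : {y} ⊆ Q.S := by simp [hS]
  have hsd : Q.S \ {x} = {y} := by
    rw [hS]
    ext v
    simp only [Finset.mem_sdiff, Finset.mem_insert, Finset.mem_singleton]
    constructor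
    · tauto
    · rintro rfl
      exact ⟨Or.inr rfl, hxy.symm⟩
  have hxne : ({x} : Finset V) ≠ Q.S := by
    rw [hS]
    exact fun h ↦ hxy.symm (by simpa using (Finset.ext_iff.1 h y))
  have hyne : ({y} : Finset V) ≠ Q.S := by
    rw [hS]
    exact fun h ↦ hxy (by simpa using (Finset.ext_iff.1 h x))
  have hadd := h.cut_add_cut_sdiff hxS
  rw [hsd] at hadd
  have hsp := h.special
  have hcy := h.le_cut _ hyS (Finset.singleton_nonempty y) hyne hy
  have hpar := h.two_dvd_cut_sub hxS
  have htot := h.total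
  have hends := sum_exc_eq_of_ends h.ends
  have hcx : Q.cut {x} = ∑ e, sepInd (Q.s e) (Q.t e) {x} + (Q.o x + Q.i x) := by simp [cut]
  simp only [hS, Finset.sum_pair hxy, Finset.sum_singleton] at hadd hsp hcy hpar htot hends
  set p := ∑ e, sepInd (Q.s e) (Q.t e) {x} with hp
  have hox := h.o_nonneg x
  have hix := h.i_nonneg x
  obtain ⟨r, hr, hr2, hrm⟩ : ∃ r, |r| ≤ p ∧ 2 ∣ p - r ∧ 2 * m ∣ (Q.b x - Q.o x + Q.i x) - r := by
    by_cases hx : ({x} : Finset V) = {v0} ∧ 2 * m ∣ Q.b v0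
    · have hx0 := hx.2
      rw [← Finset.singleton_inj.1 hx.1] at hx0
      have h2 : 2 ∣ Q.b x := (dvd_mul_right 2 m).trans hx0
      have : circDist m (Q.b x + Q.b y) = circDist m (Q.b y) := circDist_congr (by simpa using hx0)
      refine ⟨Q.i x - Q.o x, ?_, by omega, ?_⟩
      · rw [abs_le]
        omega
      · rwa [show Q.b x - Q.o x + Q.i x - (Q.i x - Q.o x) = Q.b x by ring]
    · have hcx' := h.le_cut _ hxS (Finset.singleton_nonempty x) hxne hx
      rw [Finset.sum_singleton] at hcx'
      have := circDist_add_le hm (Q.b x) (Q.b y)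
      exact exists_abs_le_dvd_sub hm (by omega) (by omega)
  have hinc : ∀ e, |incInd (Q.s e) (Q.t e) x| = sepInd (Q.s e) (Q.t e) {x} :=
    fun e ↦ abs_incInd _ _ _
  obtain ⟨σ, hσ, hs⟩ := exists_sign_sum (fun e ↦ incInd (Q.s e) (Q.t e) x) (fun e ↦ by
    rw [hinc]
    unfold sepInd
    split_ifs <;> norm_num) Finset.univ r (by simpa only [hinc]) (by simpa only [hinc])
  have hx : 2 * m ∣ Q.exc σ x - Q.b x := by
    have := dvd_neg.2 hrm
    rwa [show -(Q.b x - Q.o x + Q.i x - r) = Q.exc σ x - Q.b x by rw [exc, hs]; ring] at this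
  refine ⟨σ, hσ, fun v hv ↦ ?_⟩
  rw [hS, Finset.mem_insert, Finset.mem_singleton] at hv
  rcases hv with rfl | rfl
  · exact hx
  · have := dvd_sub htot hx
    rwa [← hends σ, show ∀ a b c d : ℤ, a + b - (c + d) - (a - c) = b - d by intros; ring] at this

/-! ### Contracting a set of vertices -/

/-- The result of contracting the set `A` to its element `a`. -/
def contract (Q : OrState V E) (A : Finset V) (a : V) : OrState V E where
  S := insert a (Q.S \ A)
  s e := if Q.s e ∈ A then a else Q.s e
  t e := if Q.t e ∈ A then a else Q.t e
  o v := if v = a then ∑ u ∈ A, Q.o u else Q.o v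
  i v := if v = a then ∑ u ∈ A, Q.i u else Q.i v
  b v := if v = a then ∑ u ∈ A, Q.b u else Q.b v

/-- The set of vertices that is contracted to `B`. -/
def expand (A : Finset V) (a : V) (B : Finset V) : Finset V := if a ∈ B then B ∪ A else B

section Contract

variable {A B : Finset V} {a : V}

lemma sum_expand (ha : a ∈ A) (hB : B ⊆ insert a (Q.S \ A)) (f : V → ℤ) :
    ∑ v ∈ B, (if v = a then ∑ u ∈ A, f u else f v) = ∑ v ∈ expand A a B, f v := by
  have hdis : ∀ v ∈ B, v ≠ a → v ∉ A := by
    intro v hv hva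
    have := hB hv
    simp only [Finset.mem_insert, Finset.mem_sdiff] at this
    tauto
  unfold expand
  split_ifs with h
  · have : B ∪ A = B.erase a ∪ A := by
      ext v
      simp only [Finset.mem_union, Finset.mem_erase]
      by_cases hv : v = a
      · simp [hv, ha]
      · tauto
    rw [this, Finset.sum_union, ← Finset.sum_erase_add _ _ h, if_pos rfl]
    · congr 1
      exact Finset.sum_congr rfl fun v hv ↦ if_neg (Finset.ne_of_mem_erase hv)
    · rw [Finset.disjoint_left]
      intro v hv
      exact hdis v (Finset.mem_of_mem_erase hv) (Finset.ne_of_mem_erase hv)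
  · exact Finset.sum_congr rfl fun v hv ↦ if_neg (ne_of_mem_of_not_mem hv h)

lemma mem_expand_iff (hB : B ⊆ insert a (Q.S \ A)) (u : V) :
    (if u ∈ A then a else u) ∈ B ↔ u ∈ expand A a B := by
  have hdis : u ∈ B → u ∈ A → u = a := by
    intro hv hA
    have := hB hv
    simp only [Finset.mem_insert, Finset.mem_sdiff] at this
    tauto
  unfold expand
  by_cases hu : u ∈ A <;> by_cases h : a ∈ B <;> simp only [hu, h, if_true, if_false,
    Finset.mem_union, or_true, or_false, false_iff, iff_self]
  intro hub
  exact h (hdis hub hu ▸ hub)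

/-- Cuts of the contraction are cuts of the original graph; this is why the cut condition survives
contraction. -/
lemma cut_contract (ha : a ∈ A) (hB : B ⊆ insert a (Q.S \ A)) :
    (Q.contract A a).cut B = Q.cut (expand A a B) := by
  unfold cut
  rw [Finset.sum_add_distrib, Finset.sum_add_distrib, ← sum_expand ha hB, ← sum_expand ha hB]
  congr 1
  refine Finset.sum_congr rfl fun e _ ↦ ?_
  simp only [sepInd, contract, mem_expand_iff hB]

lemma sum_exc_contract (ha : a ∈ A) (hB : B ⊆ insert a (Q.S \ A)) (σ : E → ℤ) :
    ∑ v ∈ B, (Q.contract A a).exc σ v = ∑ v ∈ expand A a B, Q.exc σ v := by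
  rw [sum_exc, sum_exc, Finset.sum_sub_distrib, Finset.sum_sub_distrib, ← sum_expand ha hB,
    ← sum_expand ha hB]
  congr 1
  refine Finset.sum_congr rfl fun e _ ↦ ?_
  simp only [contract, mem_expand_iff hB]

lemma size_contract_le : (Q.contract A a).size ≤ Q.size := by
  refine Finset.card_le_card fun e he ↦ ?_
  rw [Finset.mem_filter] at he ⊢
  exact ⟨he.1, fun h ↦ he.2 (by simp only [contract, h])⟩

lemma expand_whole (hA : A ⊆ Q.S) : expand A a (insert a (Q.S \ A)) = insert a Q.S := by
  rw [expand, if_pos (Finset.mem_insert_self _ _), Finset.insert_union,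
    Finset.sdiff_union_of_subset hA]

lemma Good.contract (h : Q.Good m v0) (hA : A ⊆ Q.S) (hAS : A ≠ Q.S)
    (hA2 : 2 ≤ A.card) (ha : a ∈ A) : (Q.contract A a).Good m v0 := by
  have hwhole : expand A a (insert a (Q.S \ A)) = Q.S := by
    rw [expand_whole hA, Finset.insert_eq_of_mem (hA ha)]
  have hsub : ∀ v ∈ insert a (Q.S \ A), ({v} : Finset V) ⊆ insert a (Q.S \ A) := by
    intro v hv
    simpa using hv
  have hnot : a ∉ Q.S \ A := by simp [ha]
  have hne : (Q.S \ A).Nonempty := Finset.sdiff_nonempty.2 fun h' ↦ hAS (hA.antisymm h')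
  have hexp : ∀ B ⊆ insert a (Q.S \ A), expand A a B ⊆ Q.S := by
    intro B hB v hv
    rw [← mem_expand_iff hB] at hv
    by_cases hvA : v ∈ A
    · exact hA hvA
    · rw [if_neg hvA] at hv
      have := hB hv
      simp only [Finset.mem_insert, Finset.mem_sdiff] at this
      rcases this with rfl | h
      · exact hA ha
      · exact h.1
  have hpar : ∀ v ∈ insert a (Q.S \ A), 2 ∣ (Q.contract A a).exc (fun _ ↦ 1) v -
      (Q.contract A a).b v := by
    intro v hv
    have h1 := sum_exc_contract (Q := Q) ha (hsub v hv) (fun _ ↦ 1)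
    have h2 := sum_expand (Q := Q) ha (hsub v hv) Q.b
    rw [Finset.sum_singleton] at h1 h2
    rw [h1, show (Q.contract A a).b v = _ from h2, ← Finset.sum_sub_distrib]
    exact Finset.dvd_sum fun u hu ↦ h.parity u (hexp _ (hsub v hv) hu)
  refine ⟨?_, ?_, ?_, ?_, ?_, hpar, ?_, ?_⟩
  · change 2 ≤ (insert a (Q.S \ A)).card
    rw [Finset.card_insert_of_notMem hnot]
    have := hne.card_pos
    omega
  · intro e he
    have hst : Q.s e ≠ Q.t e := fun h' ↦ he (by simp only [OrState.contract, h'])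
    have := h.ends e hst
    simp only [OrState.contract, Finset.mem_insert, Finset.mem_sdiff]
    constructor <;> split_ifs <;> tauto
  · intro v
    simp only [OrState.contract]
    split_ifs
    exacts [Finset.sum_nonneg fun u _ ↦ h.o_nonneg u, h.o_nonneg v]
  · intro v
    simp only [OrState.contract]
    split_ifs
    exacts [Finset.sum_nonneg fun u _ ↦ h.i_nonneg u, h.i_nonneg v]
  · have := h.total
    simp only [OrState.contract, Finset.sum_sub_distrib] at this ⊢
    rwa [sum_expand ha subset_rfl, sum_expand ha subset_rfl, sum_expand ha subset_rfl, hwhole]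
  · have := h.special
    simp only [OrState.contract, Finset.sum_add_distrib] at this ⊢
    rwa [sum_expand ha subset_rfl, sum_expand ha subset_rfl, sum_expand ha subset_rfl, hwhole]
  · intro B hB hBne hBS hex
    change B ⊆ insert a (Q.S \ A) at hB
    change B ≠ insert a (Q.S \ A) at hBS
    have hb : ∑ v ∈ B, (Q.contract A a).b v = ∑ v ∈ expand A a B, Q.b v := sum_expand ha hB Q.b
    rw [cut_contract ha hB, hb]
    have hBsub : B ⊆ expand A a B := by
      unfold expand
      split_ifs
      exacts [Finset.subset_union_left, subset_rfl]
    refine h.le_cut _ (hexp B hB) (hBne.mono hBsub) (fun h' ↦ hBS ?_) ?_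
    · refine hB.antisymm fun v hv ↦ ?_
      have hvS : v ∈ expand A a B := by
        rw [h']
        simp only [Finset.mem_insert, Finset.mem_sdiff] at hv
        rcases hv with rfl | hv
        exacts [hA ha, hv.1]
      rw [← mem_expand_iff hB] at hvS
      simp only [Finset.mem_insert, Finset.mem_sdiff] at hv
      rcases hv with rfl | hv
      · rwa [if_pos ha] at hvS
      · rwa [if_neg hv.2] at hvS
    · rintro ⟨h1, h2⟩
      -- The exempt singleton is never the expansion of a set containing `a`, since that expansion
      -- contains at least two vertices.
      by_cases haB : a ∈ B
      · have : A ⊆ {v0} := by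
          rw [← h1, expand, if_pos haB]
          exact Finset.subset_union_right
        have := Finset.card_le_card this
        simp only [Finset.card_singleton] at this
        omega
      · rw [expand, if_neg haB] at h1
        refine hex ⟨h1, ?_⟩
        have : v0 ≠ a := by
          rintro rfl
          simp [h1] at haB
        simpa only [OrState.contract, if_neg this] using h2

end Contract

/-! ### Restricting to a set of vertices whose boundary is already directed -/

/-- The restriction to `A`, in which the edges leaving `A` are directed by `σ` and become arcs from
or to the special vertex. -/
def inner (Q : OrState V E) (A : Finset V) (a : V) (σ : E → ℤ) : OrState V E where
  S := A
  s e := if Q.s e ∈ A ∧ Q.t e ∈ A then Q.s e else a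
  t e := if Q.s e ∈ A ∧ Q.t e ∈ A then Q.t e else a
  o v := Q.o v + ∑ e, max (σ e * incInd (Q.s e) (Q.t e) v * sepInd (Q.s e) (Q.t e) A) 0
  i v := Q.i v + ∑ e, max (-(σ e * incInd (Q.s e) (Q.t e) v * sepInd (Q.s e) (Q.t e) A)) 0
  b := Q.b

section Inner

variable {A B : Finset V} {a : V} {σ : E → ℤ}

/-- An edge leaving `A` is turned into one arc at its end in `A`, and is still counted by any cut
that contains this end. -/
lemma cut_inner (hσ : ∀ e, σ e = 1 ∨ σ e = -1) (hB : B ⊆ A) :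
    (Q.inner A a σ).cut B = Q.cut B := by
  have h1 : ∀ x : ℤ, max x 0 + max (-x) 0 = |x| := by
    intro x
    rcases abs_cases x with ⟨h, h'⟩ | ⟨h, h'⟩ <;> omega
  have h2 : ∀ v, (Q.inner A a σ).o v + (Q.inner A a σ).i v = (Q.o v + Q.i v) +
      ∑ e, sepInd (Q.s e) (Q.t e) {v} * sepInd (Q.s e) (Q.t e) A := by
    intro v
    simp only [inner]
    rw [show ∀ a b c d : ℤ, a + b + (c + d) = (a + c) + (b + d) by intros; ring,
      ← Finset.sum_add_distrib]
    congr 1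
    refine Finset.sum_congr rfl fun e _ ↦ ?_
    rw [h1, abs_mul, abs_mul, abs_incInd, abs_of_nonneg (sepInd_nonneg _ _ A)]
    rcases hσ e with h | h <;> simp [h]
  unfold cut
  simp_rw [h2]
  rw [Finset.sum_add_distrib, Finset.sum_comm, add_left_comm, ← Finset.sum_add_distrib, add_comm]
  congr 1
  refine Finset.sum_congr rfl fun e _ ↦ ?_
  rw [← Finset.sum_mul]
  by_cases hs : Q.s e ∈ A <;> by_cases ht : Q.t e ∈ A
  · simp [inner, sepInd, hs, ht]
  · have ht' : Q.t e ∉ B := fun h ↦ ht (hB h)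
    have : ∀ v ∈ B, sepInd (Q.s e) (Q.t e) {v} = if v = Q.s e then 1 else 0 := by
      intro v hv
      have : Q.t e ≠ v := (ne_of_mem_of_not_mem hv ht').symm
      simp [sepInd, this, eq_comm]
    rw [Finset.sum_congr rfl this]
    simp [inner, sepInd, hs, ht, ht']
  · have hs' : Q.s e ∉ B := fun h ↦ hs (hB h)
    have : ∀ v ∈ B, sepInd (Q.s e) (Q.t e) {v} = if v = Q.t e then 1 else 0 := by
      intro v hv
      have : Q.s e ≠ v := (ne_of_mem_of_not_mem hv hs').symm
      simp [sepInd, this, eq_comm]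
    rw [Finset.sum_congr rfl this]
    simp [inner, sepInd, hs, ht, hs']
  · have hs' : Q.s e ∉ B := fun h ↦ hs (hB h)
    have ht' : Q.t e ∉ B := fun h ↦ ht (hB h)
    simp [inner, sepInd, hs, ht, hs', ht']

lemma exc_inner (σ' : E → ℤ) {v : V} (hv : v ∈ A) :
    (Q.inner A a σ).exc σ' v =
      Q.exc (fun e ↦ if Q.s e ∈ A ∧ Q.t e ∈ A then σ' e else σ e) v := by
  have h1 : ∀ x : ℤ, max x 0 - max (-x) 0 = x := by
    intro x
    omega
  have h2 : (Q.inner A a σ).o v - (Q.inner A a σ).i v = (Q.o v - Q.i v) +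
      ∑ e, σ e * incInd (Q.s e) (Q.t e) v * sepInd (Q.s e) (Q.t e) A := by
    simp only [inner]
    rw [show ∀ a b c d : ℤ, a + b - (c + d) = (a - c) + (b - d) by intros; ring,
      ← Finset.sum_sub_distrib]
    simp_rw [h1]
  unfold exc
  rw [add_sub_assoc, h2, add_left_comm, ← Finset.sum_add_distrib, add_sub_assoc, add_comm]
  congr 1
  refine Finset.sum_congr rfl fun e _ ↦ ?_
  by_cases hs : Q.s e ∈ A <;> by_cases ht : Q.t e ∈ A
  · simp [inner, sepInd, hs, ht]
  · simp [inner, sepInd, hs, ht, incInd_self]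
  · simp [inner, sepInd, hs, ht, incInd_self]
  · have h3 : Q.s e ≠ v := (ne_of_mem_of_not_mem hv hs).symm
    have h4 : Q.t e ≠ v := (ne_of_mem_of_not_mem hv ht).symm
    simp [inner, hs, ht, incInd, h3, h4]

lemma size_inner_le : (Q.inner A a σ).size ≤ Q.size := by
  refine Finset.card_le_card fun e he ↦ ?_
  rw [Finset.mem_filter] at he ⊢
  exact ⟨he.1, fun h ↦ he.2 (by simp only [inner, h])⟩

/-- The special vertex of the restriction has degree equal to the cut of `A`, so `hcut` gives
exactly its degree bound, and `hsol` gives compatibility of the totals. -/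
lemma Good.inner (h : Q.Good m v0) (hA : A ⊆ Q.S) (hAS : A ≠ Q.S) (hA2 : 2 ≤ A.card)
    (hcut : Q.cut A = 2 * m - 2 + circDist m (∑ v ∈ A, Q.b v))
    (hσ : ∀ e, σ e = 1 ∨ σ e = -1) (hsol : 2 * m ∣ ∑ v ∈ A, Q.exc σ v - ∑ v ∈ A, Q.b v) :
    (Q.inner A a σ).Good m v0 := by
  have hends : ∀ e, (Q.inner A a σ).s e ≠ (Q.inner A a σ).t e →
      (Q.inner A a σ).s e ∈ (Q.inner A a σ).S ∧ (Q.inner A a σ).t e ∈ (Q.inner A a σ).S := by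
    intro e he
    simp only [OrState.inner] at he ⊢
    split_ifs at he ⊢ with hst
    · exact hst
    · exact absurd rfl he
  have hexc : ∀ v ∈ A, (Q.inner A a σ).exc σ v = Q.exc σ v := by
    intro v hv
    rw [exc_inner σ hv]
    simp
  refine ⟨hA2, hends, fun v ↦ ?_, fun v ↦ ?_, ?_, ?_, ?_, ?_⟩
  · exact add_nonneg (h.o_nonneg v) (Finset.sum_nonneg fun _ _ ↦ le_max_right _ _)
  · exact add_nonneg (h.i_nonneg v) (Finset.sum_nonneg fun _ _ ↦ le_max_right _ _)
  · rw [← sum_exc_eq_of_ends hends σ]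
    change 2 * m ∣ ∑ v ∈ A, (Q.inner A a σ).exc σ v - ∑ v ∈ A, Q.b v
    rwa [Finset.sum_congr rfl hexc]
  · intro v hv
    have h1 := two_dvd_exc_sub (Q := Q.inner A a σ) hσ v
    have h2 := two_dvd_exc_sub (Q := Q) hσ v
    have h3 := h.parity v (hA hv)
    rw [hexc v hv] at h1
    change 2 ∣ _ - Q.b v
    omega
  · have h1 := cut_inner (Q := Q) (a := a) hσ (subset_refl A)
    rw [hcut, cut, Finset.sum_eq_zero, zero_add] at h1
    · exact h1.le
    · intro e _
      by_cases he : (Q.inner A a σ).s e = (Q.inner A a σ).t e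
      · rw [he, sepInd_self]
      · have : (Q.inner A a σ).s e ∈ A ∧ (Q.inner A a σ).t e ∈ A := hends e he
        simp [sepInd, this.1, this.2]
  · intro B hB hBne hBA hex
    change B ⊆ A at hB
    rw [cut_inner hσ hB]
    refine h.le_cut B (subset_trans hB hA) hBne (fun h' ↦ hAS ?_) hex
    exact hA.antisymm (h' ▸ hB)

/-- A set with smallest possible cut splits the problem into two smaller ones. -/
lemma Good.solvable_of_critical (h : Q.Good m v0) (hA : A ⊆ Q.S) (hAS : A ≠ Q.S)
    (hA2 : 2 ≤ A.card) (ha : a ∈ A)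
    (hcut : Q.cut A = 2 * m - 2 + circDist m (∑ v ∈ A, Q.b v))
    (h1 : (Q.contract A a).Solvable m)
    (h2 : ∀ σ, (Q.inner A a σ).Good m v0 → (Q.inner A a σ).Solvable m) : Q.Solvable m := by
  obtain ⟨σ, hσ, hs⟩ := h1
  have hB : ∀ v ∈ insert a (Q.S \ A), 2 * m ∣ ∑ u ∈ expand A a {v}, Q.exc σ u -
      ∑ u ∈ expand A a {v}, Q.b u := by
    intro v hv
    have hv' : ({v} : Finset V) ⊆ insert a (Q.S \ A) := by simpa using hv
    rw [← sum_exc_contract ha hv', ← sum_expand ha hv']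
    rw [Finset.sum_singleton, Finset.sum_singleton]
    exact hs v hv
  obtain ⟨τ, hτ, ht⟩ := h2 σ (h.inner hA hAS hA2 hcut hσ (by
    have := hB a (Finset.mem_insert_self _ _)
    rwa [expand, if_pos (Finset.mem_singleton_self a), Finset.union_eq_right.2 (by simpa)] at this))
  -- Use the inner solution inside `A` and the solution of the contraction elsewhere; edges inside
  -- `A` do not affect vertices outside it.
  refine ⟨fun e ↦ if Q.s e ∈ A ∧ Q.t e ∈ A then τ e else σ e, fun e ↦ ?_, fun v hv ↦ ?_⟩
  · dsimp only
    split_ifs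
    exacts [hτ e, hσ e]
  · by_cases hvA : v ∈ A
    · rw [← exc_inner τ hvA (a := a)]
      exact ht v hvA
    · have := hB v (Finset.mem_insert_of_mem (Finset.mem_sdiff.2 ⟨hv, hvA⟩))
      have hav : a ≠ v := ne_of_mem_of_not_mem ha hvA
      rw [expand, if_neg (by simpa using hav), Finset.sum_singleton, Finset.sum_singleton] at this
      convert this using 2
      unfold exc
      congr 2
      refine Finset.sum_congr rfl fun e _ ↦ ?_
      dsimp only
      split_ifs with hst
      · have h3 : Q.s e ≠ v := ne_of_mem_of_not_mem hst.1 hvA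
        have h4 : Q.t e ≠ v := ne_of_mem_of_not_mem hst.2 hvA
        simp [incInd, h3, h4]
      · rfl

end Inner

end OrState

/-! ### Local reductions and their effect on cuts -/

namespace OrState

variable {V E : Type*} [DecidableEq V] [Fintype E] [DecidableEq E] {Q Q' : OrState V E} {m : ℤ}
  {v0 v x y : V} {e e₁ e₂ : E}

/-- Every orientation of `Q'` gives an orientation of `Q` with the same deviations from the
required excesses. -/
def Reduces (Q Q' : OrState V E) : Prop :=
  Q'.S = Q.S ∧ ∀ σ' : E → ℤ, (∀ e, σ' e = 1 ∨ σ' e = -1) →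
    ∃ σ : E → ℤ, (∀ e, σ e = 1 ∨ σ e = -1) ∧
      ∀ v, Q.exc σ v - Q.b v = Q'.exc σ' v - Q'.b v

lemma Reduces.solvable (hr : Q.Reduces Q') (h : Q'.Solvable m) : Q.Solvable m := by
  obtain ⟨σ', hσ', h⟩ := h
  obtain ⟨σ, hσ, hs⟩ := hr.2 σ' hσ'
  exact ⟨σ, hσ, fun v hv ↦ hs v ▸ h v (hr.1 ▸ hv)⟩

/-- Totals and parities depend only on deviations from the required excesses, which a reduction
preserves, so only the ends of edges, signs and inequalities remain to be checked. -/
lemma Good.of_reduces (h : Q.Good m v0) (hr : Q.Reduces Q')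
    (hends : ∀ e, Q'.s e ≠ Q'.t e → Q'.s e ∈ Q.S ∧ Q'.t e ∈ Q.S)
    (ho : ∀ v, 0 ≤ Q'.o v) (hi : ∀ v, 0 ≤ Q'.i v)
    (hs : ∑ v ∈ Q.S, (Q'.o v + Q'.i v) ≤ 2 * m - 2 + circDist m (∑ v ∈ Q.S, Q'.b v))
    (hc : ∀ A ⊆ Q.S, A.Nonempty → A ≠ Q.S → ¬ (A = {v0} ∧ 2 * m ∣ Q'.b v0) →
      2 * m - 2 + circDist m (∑ v ∈ A, Q'.b v) ≤ Q'.cut A) : Q'.Good m v0 := by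
  obtain ⟨hS, hr⟩ := hr
  obtain ⟨σ, hσ, hs'⟩ := hr (fun _ ↦ 1) fun _ ↦ Or.inl rfl
  rw [← hS] at hends hs hc
  refine ⟨hS ▸ h.two, hends, ho, hi, ?_, fun v hv ↦ ?_, hs, hc⟩
  · rw [← sum_exc_eq_of_ends hends (fun _ ↦ 1), ← Finset.sum_sub_distrib,
      ← Finset.sum_congr rfl fun v _ ↦ hs' v, Finset.sum_sub_distrib, hS,
      sum_exc_eq_of_ends h.ends]
    exact h.total
  · rw [← hs' v]
    have h1 := two_dvd_exc_sub (Q := Q) hσ v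
    have h2 := h.parity v (hS ▸ hv)
    omega

/-! ### Lifting two edges -/

/-- The result of replacing the edges `e₁`, `e₂` by an edge that joins `x` to `y`. -/
def lift (Q : OrState V E) (e₁ e₂ : E) (x y : V) : OrState V E :=
  { Q with
    s := fun f ↦ if f = e₁ then x else if f = e₂ then x else Q.s f
    t := fun f ↦ if f = e₁ then y else if f = e₂ then x else Q.t f }

lemma sum_eq_of_eq_off_pair {F G : E → ℤ} (he : e₁ ≠ e₂)
    (h : ∀ f, f ≠ e₁ → f ≠ e₂ → F f = G f) :
    ∑ f, F f = ∑ f, G f - G e₁ - G e₂ + F e₁ + F e₂ := by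
  rw [sum_eq_of_eq_off (F := F) (G := Function.update G e₁ (F e₁)) e₂,
    sum_eq_of_eq_off (F := Function.update G e₁ (F e₁)) (G := G) e₁]
  · rw [Function.update_self, Function.update_of_ne he.symm]
    ring
  · exact fun f hf ↦ Function.update_of_ne hf _ _
  · intro f hf
    by_cases hf' : f = e₁
    · rw [hf', Function.update_self]
    · rw [Function.update_of_ne hf', h f hf' hf]

lemma cut_lift (he : e₁ ≠ e₂) (h₁ : Q.Joins e₁ v x) (h₂ : Q.Joins e₂ v y) (A : Finset V) :
    (Q.lift e₁ e₂ x y).cut A = Q.cut A - sepInd v x A - sepInd v y A + sepInd x y A := by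
  unfold cut
  rw [sum_eq_of_eq_off_pair (G := fun e ↦ sepInd (Q.s e) (Q.t e) A) he]
  · rw [h₁.sepInd_eq, h₂.sepInd_eq]
    simp only [lift, if_true, he.symm, if_false, sepInd_self]
    ring
  · intro f hf hf'
    simp only [lift, hf, hf', if_false]

lemma reduces_lift (he : e₁ ≠ e₂) (h₁ : Q.Joins e₁ v x) (h₂ : Q.Joins e₂ v y) :
    Q.Reduces (Q.lift e₁ e₂ x y) := by
  refine ⟨rfl, fun σ' hσ' ↦ ?_⟩
  obtain ⟨ε₁, hε₁, g₁⟩ := h₁.exists_incInd_eq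
  obtain ⟨ε₂, hε₂, g₂⟩ := h₂.exists_incInd_eq
  -- The two old edges are directed as a path through `v` following the new edge, so they cancel at
  -- `v`.
  refine ⟨fun f ↦ if f = e₁ then - ε₁ * σ' e₁ else if f = e₂ then ε₂ * σ' e₁ else σ' f,
    fun f ↦ ?_, fun u ↦ ?_⟩
  · dsimp only
    split_ifs
    · rcases hε₁ with rfl | rfl <;> rcases hσ' e₁ with h | h <;> simp [h]
    · rcases hε₂ with rfl | rfl <;> rcases hσ' e₁ with h | h <;> simp [h]
    · exact hσ' f
  · have h1 : ε₁ * ε₁ = 1 := by rcases hε₁ with rfl | rfl <;> rfl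
    have h2 : ε₂ * ε₂ = 1 := by rcases hε₂ with rfl | rfl <;> rfl
    unfold exc
    rw [sum_eq_of_eq_off_pair (G := fun e ↦ σ' e * incInd ((Q.lift e₁ e₂ x y).s e)
      ((Q.lift e₁ e₂ x y).t e) u) he]
    · rw [g₁, g₂]
      simp only [lift, if_true, he.symm, if_false, incInd_self]
      simp only [incInd]
      linear_combination (-σ' e₁ * ((if v = u then 1 else 0) - (if x = u then 1 else 0))) * h1 +
        (σ' e₁ * ((if v = u then 1 else 0) - (if y = u then 1 else 0))) * h2
    · intro f hf hf'
      simp only [lift, hf, hf', if_false]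

lemma size_lift_lt (he : e₁ ≠ e₂) (h₁ : Q.Joins e₁ v x) (h₂ : Q.Joins e₂ v y) :
    (Q.lift e₁ e₂ x y).size < Q.size := by
  refine Finset.card_lt_card ((Finset.ssubset_iff_of_subset fun f hf ↦ ?_).2 ⟨e₂, ?_, ?_⟩)
  · rw [Finset.mem_filter] at hf ⊢
    refine ⟨hf.1, ?_⟩
    by_cases hf1 : f = e₁
    · exact hf1 ▸ h₁.ne
    · by_cases hf2 : f = e₂
      · exact hf2 ▸ h₂.ne
      · simpa [lift, hf1, hf2] using hf
  · simpa using h₂.ne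
  · rw [Finset.mem_filter, not_and, not_not]
    intro _
    simp only [lift, he.symm, if_true, if_false]

/-- A cut shrinks only if it separates `v` from both `x` and `y`, and then by two; slack is needed
for these sets alone. -/
lemma Good.lift (h : Q.Good m v0) (he : e₁ ≠ e₂) (h₁ : Q.Joins e₁ v x)
    (h₂ : Q.Joins e₂ v y)
    (hv : ∀ A ⊆ Q.S, A.Nonempty → A ≠ Q.S → ¬ (A = {v0} ∧ 2 * m ∣ Q.b v0) →
      (v ∈ A ∧ x ∉ A ∧ y ∉ A ∨ v ∉ A ∧ x ∈ A ∧ y ∈ A) →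
      2 * m + circDist m (∑ v ∈ A, Q.b v) ≤ Q.cut A) :
    (Q.lift e₁ e₂ x y).Good m v0 := by
  refine h.of_reduces (reduces_lift he h₁ h₂) (fun f hf ↦ ?_) h.o_nonneg h.i_nonneg h.special ?_
  · simp only [OrState.lift] at hf ⊢
    split_ifs at hf ⊢
    · exact ⟨(h.joins_mem h₁).2, (h.joins_mem h₂).2⟩
    · exact absurd rfl hf
    · exact h.ends f hf
  · intro A hA hne hAS hex
    have h3 := h.le_cut A hA hne hAS hex
    have h4 := hv A hA hne hAS hex
    rw [cut_lift he h₁ h₂]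
    change _ + circDist m (∑ v ∈ A, Q.b v) ≤ _
    by_cases hvA : v ∈ A <;> by_cases hxA : x ∈ A <;> by_cases hyA : y ∈ A <;>
      simp only [sepInd, hvA, hxA, hyA, if_true, if_false, iff_self, iff_false, iff_true,
        not_true, not_false_iff, and_true, and_false, or_false, or_true, forall_true_left] at h4 ⊢ <;> omega

/-! ### Lifting an edge and an arc to the special vertex -/

/-- The result of deleting `e` and replacing an arc from `v` by one from `x`. -/
def liftOut (Q : OrState V E) (e : E) (v x : V) : OrState V E :=
  { Q with
    s := fun f ↦ if f = e then x else Q.s f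
    t := fun f ↦ if f = e then x else Q.t f
    o := fun u ↦ Q.o u - (if u = v then 1 else 0) + (if u = x then 1 else 0) }

lemma cut_liftOut (he : Q.Joins e v x) (A : Finset V) :
    (Q.liftOut e v x).cut A =
      Q.cut A - sepInd v x A - (if v ∈ A then 1 else 0) + (if x ∈ A then 1 else 0) := by
  unfold cut
  rw [sum_eq_of_eq_off (G := fun e ↦ sepInd (Q.s e) (Q.t e) A) e]
  · rw [he.sepInd_eq]
    simp only [liftOut, if_true, sepInd_self, Finset.sum_add_distrib, Finset.sum_sub_distrib,
      Finset.sum_ite_eq']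
    ring
  · intro f hf
    simp only [liftOut, hf, if_false]

lemma exists_sign_mul_incInd (he : Q.Joins e x y) :
    ∃ δ : ℤ, (δ = 1 ∨ δ = -1) ∧ ∀ u, δ * incInd (Q.s e) (Q.t e) u = incInd x y u := by
  obtain ⟨ε, hε, g⟩ := he.exists_incInd_eq
  refine ⟨ε, hε, fun u ↦ ?_⟩
  rw [g u]
  rcases hε with rfl | rfl <;> ring

lemma reduces_liftOut (he : Q.Joins e v x) : Q.Reduces (Q.liftOut e v x) := by
  refine ⟨rfl, fun σ' hσ' ↦ ?_⟩
  obtain ⟨δ, hδ, g⟩ := exists_sign_mul_incInd he.symm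
  refine ⟨fun f ↦ if f = e then δ else σ' f, fun f ↦ ?_, fun u ↦ ?_⟩
  · dsimp only
    split_ifs
    exacts [hδ, hσ' f]
  · unfold exc
    rw [sum_eq_of_eq_off (G := fun f ↦ σ' f * incInd ((Q.liftOut e v x).s f)
      ((Q.liftOut e v x).t f) u) e]
    · dsimp only
      rw [if_pos rfl, g]
      simp only [liftOut, if_true, incInd_self]
      simp only [incInd, eq_comm (b := u)]
      ring
    · intro f hf
      simp only [liftOut, hf, if_false]

lemma size_lt_of_loop (he : Q.s e ≠ Q.t e) (he' : Q'.s e = Q'.t e)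
    (hs : ∀ f, f ≠ e → Q'.s f = Q.s f) (ht : ∀ f, f ≠ e → Q'.t f = Q.t f) :
    Q'.size < Q.size := by
  refine Finset.card_lt_card ((Finset.ssubset_iff_of_subset fun f hf ↦ ?_).2 ⟨e, ?_, ?_⟩)
  · rw [Finset.mem_filter] at hf ⊢
    refine ⟨hf.1, ?_⟩
    by_cases hfe : f = e
    · exact hfe ▸ he
    · rw [← hs f hfe, ← ht f hfe]
      exact hf.2
  · simpa using he
  · simpa using he'

/-- A set loses two from its cut if it contains `v` but not `x`, and nothing otherwise: the edge
becomes directed from `x` to `v`, then continues along the arc. -/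
lemma Good.liftOut (h : Q.Good m v0) (he : Q.Joins e v x) (ho : 0 < Q.o v)
    (hv : ∀ A ⊆ Q.S, A.Nonempty → A ≠ Q.S → ¬ (A = {v0} ∧ 2 * m ∣ Q.b v0) → v ∈ A →
      2 * m + circDist m (∑ v ∈ A, Q.b v) ≤ Q.cut A) :
    (Q.liftOut e v x).Good m v0 := by
  refine h.of_reduces (reduces_liftOut he) (fun f hf ↦ ?_) (fun u ↦ ?_) h.i_nonneg ?_ ?_
  · simp only [OrState.liftOut] at hf ⊢
    split_ifs at hf ⊢
    · exact absurd rfl hf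
    · exact h.ends f hf
  · have := h.o_nonneg u
    simp only [OrState.liftOut]
    split_ifs with h1 h2 <;> subst_vars <;> omega
  · have hvx := h.joins_mem he
    have := h.special
    simp only [OrState.liftOut, Finset.sum_add_distrib, Finset.sum_sub_distrib,
      Finset.sum_ite_eq', hvx.1, hvx.2, if_true] at this ⊢
    omega
  · intro A hA hne hAS hex
    have h3 := h.le_cut A hA hne hAS hex
    have h4 := hv A hA hne hAS hex
    rw [cut_liftOut he]
    change _ + circDist m (∑ v ∈ A, Q.b v) ≤ _
    by_cases hvA : v ∈ A <;> by_cases hxA : x ∈ A <;>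
      simp only [sepInd, hvA, hxA, if_true, if_false, iff_self, iff_false, iff_true,
        not_true, forall_true_left] at h4 ⊢ <;> omega

/-! ### Deleting an edge, and adding arcs to the special vertex -/

/-- The result of deleting the edge `e`, directed from `y` to `x`, after adding `j` arcs from `x`
to the special vertex. -/
def dropEdge (Q : OrState V E) (e : E) (x y : V) (j : ℤ) : OrState V E :=
  { Q with
    s := fun f ↦ if f = e then x else Q.s f
    t := fun f ↦ if f = e then x else Q.t f
    o := fun u ↦ Q.o u + (if u = x then j else 0)
    b := fun u ↦ Q.b u + (if u = x then j + 1 else 0) - (if u = y then 1 else 0) }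

lemma cut_dropEdge {j : ℤ} (he : Q.Joins e x y) (A : Finset V) :
    (Q.dropEdge e x y j).cut A = Q.cut A - sepInd x y A + (if x ∈ A then j else 0) := by
  unfold cut
  rw [sum_eq_of_eq_off (G := fun e ↦ sepInd (Q.s e) (Q.t e) A) e]
  · rw [he.sepInd_eq]
    simp only [dropEdge, if_true, sepInd_self, Finset.sum_add_distrib, Finset.sum_ite_eq']
    ring
  · intro f hf
    simp only [dropEdge, hf, if_false]

lemma sum_b_dropEdge {j : ℤ} (A : Finset V) : ∑ v ∈ A, (Q.dropEdge e x y j).b v =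
    ∑ v ∈ A, Q.b v + (if x ∈ A then j + 1 else 0) - (if y ∈ A then 1 else 0) := by
  simp only [dropEdge, Finset.sum_add_distrib, Finset.sum_sub_distrib, Finset.sum_ite_eq']

lemma reduces_dropEdge {j : ℤ} (he : Q.Joins e x y) : Q.Reduces (Q.dropEdge e x y j) := by
  refine ⟨rfl, fun σ' hσ' ↦ ?_⟩
  obtain ⟨δ, hδ, g⟩ := exists_sign_mul_incInd he.symm
  refine ⟨fun f ↦ if f = e then δ else σ' f, fun f ↦ ?_, fun u ↦ ?_⟩
  · dsimp only
    split_ifs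
    exacts [hδ, hσ' f]
  · unfold exc
    rw [sum_eq_of_eq_off (G := fun f ↦ σ' f * incInd ((Q.dropEdge e x y j).s f)
      ((Q.dropEdge e x y j).t f) u) e]
    · dsimp only
      rw [if_pos rfl, g]
      simp only [dropEdge, if_true, incInd_self]
      simp only [incInd, eq_comm (b := u)]
      split_ifs <;> ring
    · intro f hf
      simp only [dropEdge, hf, if_false]

/-- All nontrivial sets of vertices satisfy the condition on cuts with room to spare. -/
def Slack (m : ℤ) (Q : OrState V E) : Prop :=
  ∀ A ⊆ Q.S, 2 ≤ A.card → A ≠ Q.S → 2 * m + circDist m (∑ v ∈ A, Q.b v) ≤ Q.cut A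

lemma Slack.mirror (hm : 0 < m) (h : Q.Slack m) : Q.mirror.Slack m := by
  intro A hA hA2 hAS
  rw [cut_mirror]
  simp only [OrState.mirror, Finset.sum_neg_distrib, circDist_neg hm]
  exact h A hA hA2 hAS

/-- On nontrivial sets the cut minus its lower bound drops by at most two, which `Slack` absorbs.
Only single vertices and the special vertex need separate hypotheses. -/
lemma Good.dropEdge {j : ℤ} (hm : 0 < m) (h : Q.Good m v0) (he : Q.Joins e x y) (hj : 0 ≤ j)
    (hN : Q.Slack m)
    (hS : ∀ u ∈ Q.S, 2 * m - 2 + circDist m (Q.b u) ≤ Q.cut {u})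
    (hx : 2 * m - 2 + circDist m (Q.b x + (j + 1)) ≤ Q.cut {x} + j - 1)
    (hy : 2 * m - 2 + circDist m (Q.b y - 1) ≤ Q.cut {y} - 1)
    (hs : ∑ v ∈ Q.S, (Q.o v + Q.i v) + j ≤ 2 * m - 2 + circDist m (∑ v ∈ Q.S, Q.b v + j)) :
    (Q.dropEdge e x y j).Good m v0 := by
  have hxy := h.joins_mem he
  refine h.of_reduces (reduces_dropEdge he) (fun f hf ↦ ?_) (fun u ↦ ?_) h.i_nonneg ?_ ?_
  · simp only [OrState.dropEdge] at hf ⊢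
    split_ifs at hf ⊢
    · exact absurd rfl hf
    · exact h.ends f hf
  · have := h.o_nonneg u
    simp only [OrState.dropEdge]
    split_ifs <;> omega
  · rw [sum_b_dropEdge, if_pos hxy.1, if_pos hxy.2, ← add_assoc, add_sub_cancel_right]
    simp only [OrState.dropEdge, Finset.sum_add_distrib, Finset.sum_ite_eq', hxy.1,
      if_true] at hs ⊢
    omega
  · intro A hA hne hAS _
    rw [cut_dropEdge he, sum_b_dropEdge]
    rcases Nat.lt_or_ge A.card 2 with hc | hc
    · obtain ⟨u, rfl⟩ := Finset.card_eq_one.1 (le_antisymm (by omega) hne.card_pos)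
      rw [Finset.sum_singleton]
      simp only [sepInd, Finset.mem_singleton]
      by_cases h1 : x = u
      · have h2 : y ≠ u := fun h2 ↦ he.1 (h1.trans h2.symm)
        subst h1
        simp only [h2, if_true, if_false, true_iff, sub_zero]
        omega
      · by_cases h2 : y = u
        · subst h2
          simp only [h1, if_true, if_false, false_iff, not_true, add_zero]
          omega
        · simp only [h1, h2, if_true, if_false, sub_zero, add_zero]
          exact hS u (hA (Finset.mem_singleton_self u))
    · have h3 := hN A hA hc hAS
      set β := ∑ v ∈ A, Q.b v
      by_cases h1 : x ∈ A <;> by_cases h2 : y ∈ A <;>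
        simp only [sepInd, h1, h2, if_true, if_false, iff_self, iff_false, iff_true, not_true,
          sub_zero, add_zero]
      · have := circDist_add_abs_le hm β j
        rw [abs_of_nonneg hj] at this
        rw [← add_assoc, add_sub_cancel_right]
        omega
      · have := circDist_add_abs_le hm β (j + 1)
        rw [abs_of_nonneg (by omega)] at this
        omega
      · have := circDist_add_abs_le hm β (-1)
        norm_num [← sub_eq_add_neg] at this
        omega
      · omega

/-! ### Deleting an arc to the special vertex -/

/-- The result of deleting an arc from `v` to the special vertex. -/
def dropOut (Q : OrState V E) (v : V) : OrState V E :=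
  { Q with
    o := fun u ↦ Q.o u - (if u = v then 1 else 0)
    b := fun u ↦ Q.b u - (if u = v then 1 else 0) }

lemma cut_dropOut (A : Finset V) :
    (Q.dropOut v).cut A = Q.cut A - (if v ∈ A then 1 else 0) := by
  unfold cut
  simp only [dropOut, Finset.sum_add_distrib, Finset.sum_sub_distrib, Finset.sum_ite_eq']
  ring

lemma sum_b_dropOut (A : Finset V) :
    ∑ u ∈ A, (Q.dropOut v).b u = ∑ u ∈ A, Q.b u - (if v ∈ A then 1 else 0) := by
  simp only [dropOut, Finset.sum_sub_distrib, Finset.sum_ite_eq']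

lemma reduces_dropOut : Q.Reduces (Q.dropOut v) := by
  refine ⟨rfl, fun σ hσ ↦ ⟨σ, hσ, fun u ↦ ?_⟩⟩
  simp only [exc, dropOut]
  ring

lemma Good.dropOut (hm : 0 < m) (h : Q.Good m v0) (ho : 0 < Q.o v) (hv : v ∈ Q.S)
    (hN : Q.Slack m) (hS : ∀ u ∈ Q.S, 2 * m - 2 + circDist m (Q.b u) ≤ Q.cut {u})
    (hx : 2 * m - 2 + circDist m (Q.b v - 1) ≤ Q.cut {v} - 1) :
    (Q.dropOut v).Good m v0 := by
  have key : ∀ β, circDist m (β - 1) ≤ circDist m β + 1 ∧ circDist m β ≤ circDist m (β - 1) + 1 := by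
    intro β
    have h1 := circDist_add_abs_le hm β (-1)
    have h2 := circDist_add_abs_le hm (β - 1) 1
    norm_num [← sub_eq_add_neg] at h1 h2
    exact ⟨h1, h2⟩
  refine h.of_reduces reduces_dropOut h.ends (fun u ↦ ?_) h.i_nonneg ?_ ?_
  · have := h.o_nonneg u
    simp only [OrState.dropOut]
    split_ifs with h1 <;> subst_vars <;> omega
  · rw [sum_b_dropOut, if_pos hv]
    have h1 := h.special
    have h2 := (key (∑ v ∈ Q.S, Q.b v)).2
    simp only [OrState.dropOut, Finset.sum_add_distrib, Finset.sum_sub_distrib,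
      Finset.sum_ite_eq', hv, if_true] at h1 ⊢
    omega
  · intro A hA hne hAS _
    rw [cut_dropOut, sum_b_dropOut]
    rcases Nat.lt_or_ge A.card 2 with hc | hc
    · obtain ⟨u, rfl⟩ := Finset.card_eq_one.1 (le_antisymm (by omega) hne.card_pos)
      rw [Finset.sum_singleton]
      simp only [Finset.mem_singleton]
      split_ifs with h1
      · rwa [← h1]
      · simpa using hS u (hA (Finset.mem_singleton_self u))
    · have h3 := hN A hA hc hAS
      have h4 := (key (∑ v ∈ A, Q.b v)).1
      split_ifs
      · omega
      · rw [sub_zero, sub_zero]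
        omega

/-! ### Deleting an isolated vertex -/

/-- The result of deleting the vertex `v`. -/
def eraseVertex (Q : OrState V E) (v : V) : OrState V E := { Q with S := Q.S.erase v }

lemma Good.isolated (h : Q.Good m v0) (hc : Q.cut {v} = 0) :
    (∀ e, sepInd (Q.s e) (Q.t e) {v} = 0) ∧ Q.o v = 0 ∧ Q.i v = 0 := by
  rw [cut, Finset.sum_singleton] at hc
  have h1 : 0 ≤ ∑ e, sepInd (Q.s e) (Q.t e) {v} :=
    Finset.sum_nonneg fun e _ ↦ sepInd_nonneg _ _ _
  have h2 := h.o_nonneg v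
  have h3 := h.i_nonneg v
  have h4 : ∑ e, sepInd (Q.s e) (Q.t e) {v} = 0 := by omega
  rw [Finset.sum_eq_zero_iff_of_nonneg fun e _ ↦ sepInd_nonneg _ _ _] at h4
  exact ⟨fun e ↦ h4 e (Finset.mem_univ e), by omega, by omega⟩

lemma Good.solvable_of_eraseVertex (h : Q.Good m v0) (hc : Q.cut {v} = 0) (hb : 2 * m ∣ Q.b v)
    (hs : (Q.eraseVertex v).Solvable m) : Q.Solvable m := by
  obtain ⟨σ, hσ, hs⟩ := hs
  obtain ⟨h1, h2, h3⟩ := h.isolated hc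
  refine ⟨σ, hσ, fun u hu ↦ ?_⟩
  by_cases huv : u = v
  · subst huv
    rw [exc, Finset.sum_eq_zero, h2, h3]
    · simpa using hb
    · intro e _
      have := abs_incInd (Q.s e) (Q.t e) u
      rw [h1 e, abs_eq_zero] at this
      rw [this, mul_zero]
  · exact hs u (Finset.mem_erase.2 ⟨huv, hu⟩)

/-- Lifting may drain the exempt vertex completely; it can then be removed, and afterwards the
exemption applies to no set. -/
lemma Good.eraseVertex (h : Q.Good m v) (hc : Q.cut {v} = 0) (hb : 2 * m ∣ Q.b v)
    (hv : v ∈ Q.S) (h3 : 3 ≤ Q.S.card) : (Q.eraseVertex v).Good m v := by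
  obtain ⟨h1, ho, hi⟩ := h.isolated hc
  refine ⟨?_, fun e he ↦ ?_, h.o_nonneg, h.i_nonneg, ?_, fun u hu ↦ ?_, ?_, ?_⟩
  · change 2 ≤ (Q.S.erase v).card
    rw [Finset.card_erase_of_mem hv]
    omega
  · have he' := h.ends e he
    have := h1 e
    refine ⟨Finset.mem_erase.2 ⟨fun (h' : Q.s e = v) ↦ ?_, he'.1⟩,
      Finset.mem_erase.2 ⟨fun (h' : Q.t e = v) ↦ ?_, he'.2⟩⟩
    · have h2 : Q.t e ≠ v := fun h'' ↦ he (h'.trans h''.symm)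
      simp [sepInd, h', h2] at this
    · have h2 : Q.s e ≠ v := fun h'' ↦ he (h''.trans h'.symm)
      simp [sepInd, h', h2] at this
  · have h2 := h.total
    rw [← Finset.sum_erase_add _ _ hv, ← Finset.sum_erase_add _ _ hv, ho, hi] at h2
    have := dvd_add h2 hb
    change 2 * m ∣ ∑ v ∈ Q.S.erase v, (Q.o v - Q.i v) - ∑ v ∈ Q.S.erase v, Q.b v
    rwa [show ∀ a b c : ℤ, a + (0 - 0) - (b + c) + c = a - b by intros; ring] at this
  · exact h.parity u (Finset.mem_of_mem_erase hu)
  · have h2 := h.special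
    rw [← Finset.sum_erase_add _ _ hv, ← Finset.sum_erase_add _ _ hv, ho, hi] at h2
    rw [circDist_congr (y := ∑ v ∈ Q.S.erase v, Q.b v) (by simpa using hb)] at h2
    simp only [add_zero] at h2
    exact h2
  · intro A hA hne hAS _
    have hvA : v ∉ A := fun hvA ↦ (Finset.mem_erase.1 (hA hvA)).1 rfl
    refine h.le_cut A (fun u hu ↦ Finset.mem_of_mem_erase (hA hu)) hne ?_ ?_
    · rintro rfl
      exact hvA hv
    · rintro ⟨rfl, -⟩
      simp at hvA

end OrState

/-! ### The orientation theorem -/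

namespace OrState

variable {V E : Type*} [DecidableEq V] [Fintype E] [DecidableEq E] {Q Q' : OrState V E} {m : ℤ}
  {v0 v x y : V} {e e₁ e₂ : E}

lemma size_liftOut_lt (he : Q.Joins e v x) : (Q.liftOut e v x).size < Q.size :=
  size_lt_of_loop he.ne (by simp [liftOut]) (fun f hf ↦ by simp [liftOut, hf])
    (fun f hf ↦ by simp [liftOut, hf])

lemma size_dropEdge_lt {j : ℤ} (he : Q.Joins e x y) : (Q.dropEdge e x y j).size < Q.size :=
  size_lt_of_loop he.ne (by simp [dropEdge]) (fun f hf ↦ by simp [dropEdge, hf])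
    (fun f hf ↦ by simp [dropEdge, hf])

/-- At a vertex that is exempt, or whose cut is larger than required, two edges can be lifted. -/
lemma Good.exists_lift (hm : 1 < m) (h : Q.Good m v0) (h3 : 3 ≤ Q.S.card) (hN : Q.Slack m)
    (hvS : v ∈ Q.S)
    (hv : v = v0 ∧ 2 * m ∣ Q.b v ∧ Q.cut {v} ≠ 0 ∨ 2 * m + circDist m (Q.b v) ≤ Q.cut {v}) :
    ∃ Q' : OrState V E, Q'.Good m v0 ∧ Q'.S = Q.S ∧ Q'.size < Q.size ∧
      (Q'.Solvable m → Q.Solvable m) := by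
  have hm0 : 0 < m := by omega
  have hox := h.o_nonneg v
  have hix := h.i_nonneg v
  have hvs : {v} ⊆ Q.S := by simpa using hvS
  have hbig : ∀ A ⊆ Q.S, A.Nonempty → A ≠ Q.S → ¬ (A = {v0} ∧ 2 * m ∣ Q.b v0) → v ∈ A →
      2 * m + circDist m (∑ v ∈ A, Q.b v) ≤ Q.cut A := by
    intro A hA hne hAS hex hvA
    rcases Nat.lt_or_ge A.card 2 with hc | hc
    · obtain ⟨u, rfl⟩ := Finset.card_eq_one.1 (le_antisymm (by omega) hne.card_pos)
      rw [Finset.mem_singleton] at hvA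
      subst hvA
      rcases hv with ⟨rfl, h2, -⟩ | hv
      · exact absurd ⟨rfl, h2⟩ hex
      · rwa [Finset.sum_singleton]
    · exact hN A hA hc hAS
  have hcut0 : 0 ≤ Q.cut {v} := by
    rw [cut, Finset.sum_singleton]
    have : 0 ≤ ∑ e, sepInd (Q.s e) (Q.t e) {v} :=
      Finset.sum_nonneg fun e _ ↦ sepInd_nonneg _ _ _
    omega
  by_cases hE : ∃ e x, Q.Joins e v x
  swap
  -- Without edges at `v`, the cuts of `v` and of its complement consist of arcs at the special
  -- vertex, and together exceed the bound on its degree.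
  · exfalso
    have h1 : ∑ e, sepInd (Q.s e) (Q.t e) {v} = 0 := by
      refine Finset.sum_eq_zero fun e _ ↦ ?_
      by_contra hne
      obtain ⟨x, hx, y, -, hj⟩ := exists_joins_of_sepInd_ne hne
      rw [Finset.mem_singleton] at hx
      exact hE ⟨e, y, hx ▸ hj⟩
    have h2 := h.cut_add_cut_sdiff hvs
    have hcard : (Q.S \ {v}).card = Q.S.card - 1 := by
      rw [Finset.card_sdiff_of_subset hvs, Finset.card_singleton]
    have h4 := hN (Q.S \ {v}) Finset.sdiff_subset (by omega) (fun h' ↦ by rw [h'] at hcard; omega)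
    have h5 := h.special
    have h6 : ∑ u ∈ Q.S, Q.b u = ∑ u ∈ Q.S \ {v}, Q.b u + Q.b v := by
      rw [← Finset.sum_sdiff hvs, Finset.sum_singleton]
    rcases hv with ⟨-, hb, -⟩ | hv
    · rw [h6, circDist_congr (y := ∑ u ∈ Q.S \ {v}, Q.b u) (by simpa using hb)] at h5
      omega
    · have := circDist_add_le hm0 (∑ u ∈ Q.S \ {v}, Q.b u) (Q.b v)
      rw [h6] at h5
      omega
  obtain ⟨e₁, x, h₁⟩ := hE
  by_cases hE : ∃ e y, y ≠ x ∧ Q.Joins e v y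
  · obtain ⟨e₂, y, hyx, h₂⟩ := hE
    have he : e₁ ≠ e₂ := by
      rintro rfl
      rcases h₁.2 with ⟨a, b⟩ | ⟨a, b⟩ <;> rcases h₂.2 with ⟨c, d⟩ | ⟨c, d⟩
      · exact hyx (d.symm.trans b)
      · exact h₁.1 (d.symm.trans b)
      · exact h₁.1 (c.symm.trans a)
      · exact hyx (c.symm.trans a)
    refine ⟨_, h.lift he h₁ h₂ ?_, rfl, size_lift_lt he h₁ h₂, (reduces_lift he h₁ h₂).solvable⟩
    rintro A hA hne hAS hex (⟨hvA, -⟩ | ⟨-, hxA, hyA⟩)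
    · exact hbig A hA hne hAS hex hvA
    · exact hN A hA (Finset.one_lt_card.2 ⟨x, hxA, y, hyA, hyx.symm⟩) hAS
  push Not at hE
  by_cases ho : 0 < Q.o v
  · exact ⟨_, h.liftOut h₁ ho hbig, rfl,
      size_liftOut_lt h₁, (reduces_liftOut h₁).solvable⟩
  by_cases hi : 0 < Q.i v
  · have h₁' : Q.mirror.Joins e₁ v x := h₁
    refine ⟨_, (h.mirror hm0).liftOut h₁' hi ?_, rfl,
      size_liftOut_lt h₁', fun hs ↦ ((reduces_liftOut h₁').solvable hs).of_mirror⟩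
    intro A hA hne hAS hex hvA
    rw [cut_mirror]
    simp only [OrState.mirror, Finset.sum_neg_distrib, circDist_neg hm0, dvd_neg] at hex ⊢
    exact hbig A hA hne hAS hex hvA
  have hcut : Q.cut {v} = ∑ e, sepInd (Q.s e) (Q.t e) {v} := by
    rw [cut, Finset.sum_singleton]
    omega
  have hsep : ∀ e, sepInd (Q.s e) (Q.t e) {v} ≠ 0 → Q.Joins e v x := by
    intro e he
    obtain ⟨w, hw, y, -, hj⟩ := exists_joins_of_sepInd_ne he
    rw [Finset.mem_singleton] at hw
    subst hw
    by_cases hy : y = x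
    · exact hy ▸ hj
    · exact absurd hj (hE e y hy)
  -- A single edge at `v` is impossible: a cut of size one violates parity at residue zero, and is
  -- below `2m` otherwise.
  obtain ⟨e₂, he, h₂⟩ : ∃ e₂, e₁ ≠ e₂ ∧ Q.Joins e₂ v x := by
    by_contra hcon
    push Not at hcon
    have h1 : Q.cut {v} = 1 := by
      rw [hcut, Finset.sum_eq_single e₁]
      · rw [h₁.sepInd_eq, sepInd, if_neg]
        simp [h₁.1.symm]
      · intro f _ hf
        by_contra hne
        exact hcon f hf.symm (hsep f hne)
      · simp
    rcases hv with ⟨-, hb, -⟩ | hv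
    · have h2 := h.two_dvd_cut_sub hvs
      rw [Finset.sum_singleton] at h2
      have h4 : 2 ∣ Q.b v := (dvd_mul_right 2 m).trans hb
      omega
    · have := circDist_nonneg hm0 (Q.b v)
      omega
  refine ⟨_, h.lift he h₁ h₂ ?_, rfl, size_lift_lt he h₁ h₂, (reduces_lift he h₁ h₂).solvable⟩
  rintro A hA hne hAS hex (⟨hvA, -⟩ | ⟨hvA, hxA, -⟩)
  · exact hbig A hA hne hAS hex hvA
  rcases Nat.lt_or_ge A.card 2 with hc | hc
  swap
  · exact hN A hA hc hAS
  obtain ⟨u, rfl⟩ := Finset.card_eq_one.1 (le_antisymm (by omega) hne.card_pos)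
  rw [Finset.mem_singleton] at hxA
  subst hxA
  rw [Finset.sum_singleton]
  have hvx : v ≠ x := h₁.1
  have hpair : ({v, x} : Finset V).card = 2 := Finset.card_pair hvx
  have h5 := hN {v, x} (by
    intro u hu
    simp only [Finset.mem_insert, Finset.mem_singleton] at hu
    rcases hu with rfl | rfl
    exacts [hvS, hA (Finset.mem_singleton_self _)]) hpair.ge (fun h' ↦ by rw [h'] at hpair; omega)
  rw [Finset.sum_pair hvx] at h5
  -- All edges at `v` go to `x` and there are no arcs at `v`, so the slack of `{v, x}` yields the
  -- slack needed at `x` before two parallel edges are removed.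
  have h6 : Q.cut {x} = Q.cut {v, x} + Q.cut {v} := by
    unfold cut
    rw [Finset.sum_pair hvx, Finset.sum_singleton, Finset.sum_singleton]
    have : ∑ e, sepInd (Q.s e) (Q.t e) {x} =
        ∑ e, sepInd (Q.s e) (Q.t e) {v, x} + ∑ e, sepInd (Q.s e) (Q.t e) {v} := by
      rw [← Finset.sum_add_distrib]
      refine Finset.sum_congr rfl fun e _ ↦ ?_
      by_cases hj : Q.Joins e v x
      · simp only [hj.sepInd_eq]
        simp [sepInd, hvx, hvx.symm]
      · have h0 : sepInd (Q.s e) (Q.t e) {v} = 0 := by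
          by_contra hne
          exact hj (hsep e hne)
        rw [h0, add_zero]
        by_cases hs : Q.s e = v <;> by_cases ht : Q.t e = v
        · rw [hs, ht, sepInd_self, sepInd_self]
        · simp [sepInd, hs, ht] at h0
        · simp [sepInd, hs, ht] at h0
        · simp [sepInd, hs, ht]
    omega
  rcases hv with ⟨-, hb, hne0⟩ | hv
  · rw [add_comm, circDist_congr (y := Q.b x) (by simpa using hb)] at h5
    omega
  · have h7 := circDist_nonneg hm0 (Q.b v + Q.b x)
    have h8 := circDist_nonneg hm0 (Q.b v)
    have h9 := circDist_le hm0 (Q.b x)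
    omega

/-- All cuts of single vertices are as small as possible, and no required excess is zero. -/
structure Tight (m : ℤ) (Q : OrState V E) : Prop where
  cut_eq : ∀ v ∈ Q.S, Q.cut {v} = 2 * m - 2 + circDist m (Q.b v)
  not_dvd : ∀ v ∈ Q.S, ¬ 2 * m ∣ Q.b v

lemma Tight.mirror (hm : 0 < m) (h : Q.Tight m) : Q.mirror.Tight m where
  cut_eq v hv := by
    rw [cut_mirror]
    simp only [OrState.mirror, circDist_neg hm]
    exact h.cut_eq v hv
  not_dvd v hv := by
    simp only [OrState.mirror, dvd_neg]
    exact h.not_dvd v hv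

/-- If all required excesses are positive, the state can be made smaller. -/
lemma Good.exists_smaller_of_pos (hm : 1 < m) (h : Q.Good m v0) (h3 : 3 ≤ Q.S.card)
    (hN : Q.Slack m) (hT : Q.Tight m)
    (hpos : ∀ v ∈ Q.S, circDist m (Q.b v - 1) = circDist m (Q.b v) - 1) :
    ∃ Q' : OrState V E, Q'.Good m v0 ∧ Q'.S = Q.S ∧ (Q'.Solvable m → Q.Solvable m) ∧
      (Q'.size < Q.size ∨ Q'.size = Q.size ∧
        ∑ v ∈ Q'.S, (Q'.o v + Q'.i v) < ∑ v ∈ Q.S, (Q.o v + Q.i v)) := by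
  have hm0 : 0 < m := by omega
  have hS : ∀ u ∈ Q.S, 2 * m - 2 + circDist m (Q.b u) ≤ Q.cut {u} := fun u hu ↦ (hT.cut_eq u hu).ge
  by_cases ho : ∃ v ∈ Q.S, 0 < Q.o v
  · obtain ⟨v, hv, ho⟩ := ho
    have h1 := hT.cut_eq v hv
    have h2 := hpos v hv
    refine ⟨_, h.dropOut hm0 ho hv hN hS (by omega), rfl, reduces_dropOut.solvable,
      Or.inr ⟨rfl, ?_⟩⟩
    simp only [OrState.dropOut, Finset.sum_add_distrib, Finset.sum_sub_distrib,
      Finset.sum_ite_eq', hv, if_true]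
    omega
  push Not at ho
  have ho' : ∀ v ∈ Q.S, Q.o v = 0 := fun v hv ↦ le_antisymm (ho v hv) (h.o_nonneg v)
  have hsum : ∑ v ∈ Q.S, (Q.o v + Q.i v) = ∑ v ∈ Q.S, Q.i v :=
    Finset.sum_congr rfl fun v hv ↦ by rw [ho' v hv, zero_add]
  have htot : 2 * m ∣ -∑ v ∈ Q.S, Q.i v - ∑ v ∈ Q.S, Q.b v := by
    have h1 := h.total
    rwa [Finset.sum_congr rfl (g := fun v ↦ - Q.i v) fun v hv ↦ by rw [ho' v hv, zero_sub],
      Finset.sum_neg_distrib] at h1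
  have hspec := h.special
  rw [hsum] at hspec
  have hi0 : 0 ≤ ∑ v ∈ Q.S, Q.i v := Finset.sum_nonneg fun v _ ↦ h.i_nonneg v
  set I := ∑ v ∈ Q.S, Q.i v with hI
  set β := ∑ v ∈ Q.S, Q.b v with hβ
  have hcong : ∀ j, circDist m (β + j) = circDist m (I - j) := by
    intro j
    rw [← circDist_neg hm0 (I - j)]
    refine circDist_congr ?_
    have := dvd_neg.2 htot
    rwa [show -(-I - β) = β + j - -(I - j) by ring] at this
  -- If `I ≥ 2m`, then `I ≤ 3m - 2` makes the residue of `I` at distance `I - 2m`, and the degree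
  -- bound becomes `I ≤ I - 2`.
  have hI2 : I ≤ 2 * m - 1 := by
    have h1 := hcong 0
    rw [add_zero, sub_zero] at h1
    rw [h1] at hspec
    by_contra hcon
    have h2 := circDist_le hm0 I
    have h4 : circDist m I = I - 2 * m := by
      rw [circDist_congr (y := I - 2 * m) (by simp), circDist_eq_abs hm0, abs_of_nonneg] <;>
        [skip; rw [abs_le]] <;> omega
    omega
  obtain ⟨e, x, y, he⟩ : ∃ e x y, Q.Joins e x y := by
    obtain ⟨v, hv⟩ : Q.S.Nonempty := Finset.card_pos.1 (by omega)
    by_contra hcon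
    push Not at hcon
    have hvs : {v} ⊆ Q.S := by simpa using hv
    have h1 : ∑ e, sepInd (Q.s e) (Q.t e) {v} = 0 := by
      refine Finset.sum_eq_zero fun e _ ↦ ?_
      by_contra hne
      obtain ⟨x, -, y, -, hj⟩ := exists_joins_of_sepInd_ne hne
      exact hcon e x y hj
    have h2 := h.cut_add_cut_sdiff hvs
    have hcard : (Q.S \ {v}).card = Q.S.card - 1 := by
      rw [Finset.card_sdiff_of_subset hvs, Finset.card_singleton]
    have h4 := hN (Q.S \ {v}) Finset.sdiff_subset (by omega) (fun h' ↦ by rw [h'] at hcard; omega)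
    have h5 := hS v hv
    have h6 := circDist_nonneg hm0 (Q.b v)
    have h7 := circDist_nonneg hm0 (∑ u ∈ Q.S \ {v}, Q.b u)
    rw [hsum] at h2
    omega
  have hx := (h.joins_mem he).1
  have hy := (h.joins_mem he).2
  have hxm := circDist_le hm0 (Q.b x)
  have hxp := hpos x hx
  have hx1 : 1 ≤ circDist m (Q.b x) := by
    have := circDist_nonneg hm0 (Q.b x - 1)
    omega
  have hxd := dvd_sub_circDist hm0 hxp
  set τ := circDist m (Q.b x) with hτ
  -- With `j = m - τ` new arcs out of `x`, its requirement becomes `m + 1`, past the farthest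
  -- residue and at distance `m - 1`; the cut of `x` becomes `3m - 3`, exactly its bound. The edge
  -- can thus be directed into `x` although the requirement at `x` is positive.
  refine ⟨_, h.dropEdge (j := m - τ) hm0 he (by omega) hN hS ?_ ?_ ?_, rfl,
    (reduces_dropEdge he).solvable, Or.inl (size_dropEdge_lt he)⟩
  · have h1 : circDist m (Q.b x + (m - τ + 1)) = m - 1 := by
      rw [circDist_congr (y := -(m - 1)), circDist_neg hm0, circDist_eq_abs hm0, abs_of_nonneg]
      · omega
      · rw [abs_le]
        omega
      · have := dvd_add hxd (dvd_refl (2 * m))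
        rwa [show Q.b x - τ + 2 * m = Q.b x + (m - τ + 1) - -(m - 1) by ring] at this
    have h2 := hT.cut_eq x hx
    omega
  · have h1 := hT.cut_eq y hy
    have h2 := hpos y hy
    omega
  · rw [hsum, hcong]
    rcases le_or_gt (I - (m - τ)) m with h1 | h1
    · rw [circDist_eq_abs hm0 (by rw [abs_le]; omega)]
      rcases abs_cases (I - (m - τ)) with ⟨h2, h4⟩ | ⟨h2, h4⟩ <;> omega
    · rw [circDist_congr (y := I - (m - τ) - 2 * m) (by simp),
        circDist_eq_abs hm0 (by rw [abs_le]; omega), abs_of_nonpos (by omega)]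
      omega

/-- If all cuts of single vertices are tight, the state can be made smaller. -/
lemma Good.exists_smaller_of_tight (hm : 1 < m) (h : Q.Good m v0) (h3 : 3 ≤ Q.S.card)
    (hN : Q.Slack m) (hT : Q.Tight m) :
    ∃ Q' : OrState V E, Q'.Good m v0 ∧ Q'.S = Q.S ∧ (Q'.Solvable m → Q.Solvable m) ∧
      (Q'.size < Q.size ∨ Q'.size = Q.size ∧
        ∑ v ∈ Q'.S, (Q'.o v + Q'.i v) < ∑ v ∈ Q.S, (Q.o v + Q.i v)) := by
  have hm0 : 0 < m := by omega
  have hS : ∀ u ∈ Q.S, 2 * m - 2 + circDist m (Q.b u) ≤ Q.cut {u} := fun u hu ↦ (hT.cut_eq u hu).ge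
  -- `P` is the set of positive vertices. Residue `m`, which approaches zero in both directions, is
  -- counted as positive.
  set P := Q.S.filter fun v ↦ circDist m (Q.b v - 1) = circDist m (Q.b v) - 1 with hP
  have hPS : P ⊆ Q.S := Finset.filter_subset _ _
  have hneg : ∀ v ∈ Q.S, v ∉ P → circDist m (Q.b v + 1) = circDist m (Q.b v) - 1 := by
    intro v hv hvP
    rcases circDist_step hm0 (hT.not_dvd v hv) with h1 | h1
    · exact absurd (Finset.mem_filter.2 ⟨hv, h1⟩) hvP
    · exact h1
  by_cases hj : ∃ e, sepInd (Q.s e) (Q.t e) P ≠ 0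
  · obtain ⟨e, he⟩ := hj
    obtain ⟨y, hy, x, hx, hj⟩ := exists_joins_of_sepInd_ne he
    have hxS := (h.joins_mem hj).2
    have hyS := (h.joins_mem hj).1
    have h1 := hneg x hxS hx
    have h2 := (Finset.mem_filter.1 hy).2
    have h4 := hT.cut_eq x hxS
    have h5 := hT.cut_eq y hyS
    -- Directing an edge from a positive to a nonpositive vertex brings both residues one step
    -- nearer to zero, compensating for the lost edge.
    refine ⟨_, h.dropEdge (j := 0) hm0 hj.symm le_rfl hN hS ?_ (by omega) ?_, rfl,
      (reduces_dropEdge hj.symm).solvable, Or.inl (size_dropEdge_lt hj.symm)⟩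
    · rw [zero_add]
      omega
    · simpa using h.special
  push Not at hj
  by_cases hP1 : P = Q.S
  · exact h.exists_smaller_of_pos hm h3 hN hT fun v hv ↦ (Finset.mem_filter.1 (hP1 ▸ hv : v ∈ P)).2
  by_cases hP0 : P = ∅
  · obtain ⟨Q', h1, h2, h4, h5⟩ := (h.mirror hm0).exists_smaller_of_pos hm h3 (hN.mirror hm0)
      (hT.mirror hm0) (fun v hv ↦ by
        have := hneg v hv (by simp [hP0])
        rw [← circDist_neg hm0] at this
        simp only [OrState.mirror, circDist_neg hm0]
        rwa [neg_add'] at this)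
    refine ⟨Q', h1, h2, fun hs ↦ (h4 hs).of_mirror, h5.imp_right fun h6 ↦ ⟨h6.1, ?_⟩⟩
    refine h6.2.trans_eq (Finset.sum_congr rfl fun v _ ↦ ?_)
    simp only [OrState.mirror, add_comm]
  · exfalso
    -- With no edge between `P` and its complement, their cuts add up to the special degree,
    -- contradicting its bound by subadditivity of `circDist`.
    have hge : ∀ A ⊆ Q.S, A.Nonempty → A ≠ Q.S →
        2 * m - 2 + circDist m (∑ v ∈ A, Q.b v) ≤ Q.cut A := by
      intro A hA hne hAS
      refine h.le_cut A hA hne hAS ?_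
      rintro ⟨rfl, h2⟩
      exact hT.not_dvd v0 (hA (Finset.mem_singleton_self _)) h2
    have h1 := hge P hPS (Finset.nonempty_iff_ne_empty.2 hP0) hP1
    have h2 := hge (Q.S \ P) Finset.sdiff_subset
      (Finset.sdiff_nonempty.2 fun h' ↦ hP1 (hPS.antisymm h'))
      (fun h' ↦ hP0 (by rw [Finset.sdiff_eq_self_iff_disjoint] at h'
                        exact Finset.disjoint_self_iff_empty _ |>.1 (h'.mono_left hPS)))
    have h4 := h.cut_add_cut_sdiff hPS
    rw [Finset.sum_eq_zero fun e _ ↦ hj e] at h4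
    have h5 := h.special
    have h6 := circDist_add_le hm0 (∑ v ∈ Q.S \ P, Q.b v) (∑ v ∈ P, Q.b v)
    rw [Finset.sum_sdiff hPS] at h6
    omega

/-- The theorem of Lovász, Thomassen, Wu and Zhang on extending partial orientations. -/
theorem Good.solvable (hm : 1 < m) (h : Q.Good m v0) : Q.Solvable m := by
  have hm0 : 0 < m := by omega
  -- The induction is lexicographic: vertices plus non-loop edges, then arcs at the special vertex.
  -- `dropEdge` may add arcs but lowers the first quantity; `dropOut` lowers only the second.
  obtain ⟨n, hn⟩ : ∃ n, Q.S.card + Q.size = n := ⟨_, rfl⟩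
  obtain ⟨a, ha⟩ : ∃ a : ℕ, (∑ v ∈ Q.S, (Q.o v + Q.i v)).toNat = a := ⟨_, rfl⟩
  induction n using Nat.strong_induction_on generalizing Q a v0 with
  | _ n ihn =>
  induction a using Nat.strong_induction_on generalizing Q v0 with
  | _ a iha =>
  have ih : ∀ (w : V) (Q' : OrState V E), Q'.Good m w → Q'.S.card + Q'.size < n → Q'.Solvable m :=
    fun w Q' hQ' hlt ↦ ihn _ hlt hQ' rfl _ rfl
  rcases Nat.lt_or_ge Q.S.card 3 with hc | h3
  · exact h.solvable_of_card_eq_two hm0 (le_antisymm (by omega) h.two)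
  by_cases hN : Q.Slack m
  swap
  · unfold Slack at hN
    push Not at hN
    obtain ⟨A, hA, hA2, hAS, hlt⟩ := hN
    have hge := h.le_cut A hA (Finset.card_pos.1 (by omega)) hAS (by
      rintro ⟨rfl, -⟩
      simp at hA2)
    have heq := (h.cut_eq_or_le hm0 hA hge).resolve_right (by omega)
    obtain ⟨a, ha⟩ : A.Nonempty := Finset.card_pos.1 (by omega)
    have hAlt : A.card < Q.S.card := Finset.card_lt_card (hA.ssubset_of_ne hAS)
    refine h.solvable_of_critical hA hAS hA2 ha heq (ih v0 _ (h.contract hA hAS hA2 ha) ?_)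
      fun σ hσ ↦ ih v0 _ hσ ?_
    · have h1 : (Q.contract A a).size ≤ Q.size := size_contract_le
      have h2 : (Q.contract A a).S.card ≤ (Q.S \ A).card + 1 := Finset.card_insert_le _ _
      rw [Finset.card_sdiff_of_subset hA] at h2
      omega
    · have h1 : (Q.inner A a σ).size ≤ Q.size := size_inner_le
      have h2 : (Q.inner A a σ).S.card = A.card := rfl
      omega
  by_cases hz : ∃ v ∈ Q.S, 2 * m ∣ Q.b v
  -- If `v0` is not a vertex of residue zero, no set is currently exempt and the exemption may be
  -- moved to `w`.
  · obtain ⟨w, hw, hwS, hwb⟩ : ∃ w, Q.Good m w ∧ w ∈ Q.S ∧ 2 * m ∣ Q.b w := by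
      by_cases hv0 : v0 ∈ Q.S ∧ 2 * m ∣ Q.b v0
      · exact ⟨v0, h, hv0⟩
      · obtain ⟨w, hw⟩ := hz
        refine ⟨w, { h with le_cut := fun A hA hne hAS _ ↦ h.le_cut A hA hne hAS ?_ }, hw⟩
        rintro ⟨rfl, h2⟩
        exact hv0 ⟨hA (Finset.mem_singleton_self _), h2⟩
    by_cases hc0 : Q.cut {w} = 0
    · refine h.solvable_of_eraseVertex hc0 hwb (ih w _ (hw.eraseVertex hc0 hwb hwS h3) ?_)
      have h1 : (Q.eraseVertex w).S.card = Q.S.card - 1 := Finset.card_erase_of_mem hwS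
      have h2 : (Q.eraseVertex w).size = Q.size := rfl
      omega
    · obtain ⟨Q', h1, h2, h4, h5⟩ := hw.exists_lift hm h3 hN hwS (Or.inl ⟨rfl, hwb, hc0⟩)
      exact h5 (ih w Q' h1 (by rw [h2]; omega))
  push Not at hz
  by_cases hnt : ∃ v ∈ Q.S, 2 * m + circDist m (Q.b v) ≤ Q.cut {v}
  · obtain ⟨w, hwS, hw⟩ := hnt
    obtain ⟨Q', h1, h2, h4, h5⟩ := h.exists_lift hm h3 hN hwS (Or.inr hw)
    exact h5 (ih v0 Q' h1 (by rw [h2]; omega))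
  push Not at hnt
  have hT : Q.Tight m := by
    refine ⟨fun v hv ↦ ?_, hz⟩
    have hvs : {v} ⊆ Q.S := by simpa using hv
    have hge := h.le_cut {v} hvs (Finset.singleton_nonempty v)
      (fun h' ↦ by rw [← h'] at h3; simp at h3) (by
        rintro ⟨h1, h2⟩
        rw [← Finset.singleton_inj.1 h1] at h2
        exact hz v hv h2)
    have := h.cut_eq_or_le hm0 hvs hge
    rw [Finset.sum_singleton] at this
    exact this.resolve_right (hnt v hv).not_ge
  obtain ⟨Q', h1, h2, h4, h5 | ⟨h5, h6⟩⟩ := h.exists_smaller_of_tight hm h3 hN hT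
  · exact h4 (ih v0 Q' h1 (by rw [h2]; omega))
  · refine h4 (iha _ ?_ h1 (by rw [h2, h5, hn]) rfl)
    have : 0 ≤ ∑ v ∈ Q'.S, (Q'.o v + Q'.i v) :=
      Finset.sum_nonneg fun v _ ↦ add_nonneg (h1.o_nonneg v) (h1.i_nonneg v)
    omega

end OrState

/-! ### Edge cuts of graphs and maximum cuts -/

namespace Graph

variable {α β : Type*} {G : Graph α β}

lemma IsLink.mem_edgeCut_iff {e : β} {x y : α} (h : G.IsLink e x y) (A : Set α) :
    e ∈ G.edgeCut A ↔ ¬ (x ∈ A ↔ y ∈ A) := by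
  constructor
  · rintro ⟨u, hu, w, hw, h'⟩
    rcases h.eq_and_eq_or_eq_and_eq h' with ⟨rfl, rfl⟩ | ⟨rfl, rfl⟩ <;> tauto
  · intro h'
    by_cases hx : x ∈ A
    · exact ⟨x, hx, y, by tauto, h⟩
    · exact ⟨y, by tauto, x, hx, h.symm⟩

lemma edgeCut_subset (G : Graph α β) (A : Set α) : G.edgeCut A ⊆ E(G) := by
  rintro e ⟨x, -, y, -, h⟩
  exact h.edge_mem

lemma edgeCut_restrict (F : Set β) (A : Set α) :
    (G.restrict F).edgeCut A = G.edgeCut A ∩ F := by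
  ext e
  simp only [edgeCut, Set.mem_ofPred_eq, restrict_isLink, Set.mem_inter_iff]
  constructor
  · rintro ⟨x, hx, y, hy, hF, h⟩
    exact ⟨⟨x, hx, y, hy, h⟩, hF⟩
  · rintro ⟨⟨x, hx, y, hy, h⟩, hF⟩
    exact ⟨x, hx, y, hy, hF, h⟩

lemma isSpanningSubgraph_restrict (G : Graph α β) (F : Set β) : G.restrict F ≤s G :=
  ⟨restrict_le, rfl⟩

/-- A finite graph has a set of vertices whose edge cut contains half of every edge cut. -/
lemma exists_edgeCut_half (hV : V(G).Finite) (hE : E(G).Finite) :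
    ∃ X ⊆ V(G), ∀ A ⊆ V(G), (G.edgeCut A).ncard ≤ 2 * (G.edgeCut A ∩ G.edgeCut X).ncard := by
  obtain ⟨X, hX, hmax⟩ := Set.exists_max_image (𝒫 V(G)) (fun X ↦ (G.edgeCut X).ncard)
    hV.finite_subsets ⟨∅, Set.empty_subset _⟩
  refine ⟨X, hX, fun A hA ↦ ?_⟩
  have hfin : ∀ B, (G.edgeCut B).Finite := fun B ↦ hE.subset (G.edgeCut_subset B)
  -- Switching the side of every vertex of `A` swaps, within the cut of `A`, the edges that lie in
  -- the cut of `X` with those that do not.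
  have h1 := hmax (symmDiff X A) (Set.symmDiff_subset_union.trans (Set.union_subset hX hA))
  have h2 : G.edgeCut (symmDiff X A) =
      (G.edgeCut X \ G.edgeCut A) ∪ (G.edgeCut A \ G.edgeCut X) := by
    ext e
    by_cases he : e ∈ E(G)
    · obtain ⟨x, y, h⟩ := exists_isLink_of_mem_edgeSet he
      simp only [Set.mem_union, Set.mem_sdiff, h.mem_edgeCut_iff, Set.mem_symmDiff]
      tauto
    · simp only [Set.mem_union, Set.mem_sdiff]
      have := fun B (h : e ∈ G.edgeCut B) ↦ he (G.edgeCut_subset B h)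
      tauto
  have h3 : (G.edgeCut (symmDiff X A)).ncard =
      (G.edgeCut X \ G.edgeCut A).ncard + (G.edgeCut A \ G.edgeCut X).ncard := by
    rw [h2, Set.ncard_union_eq _ (hfin X).sdiff (hfin A).sdiff]
    exact disjoint_sdiff_sdiff
  have h4 := Set.ncard_inter_add_ncard_sdiff_eq_ncard (G.edgeCut X) (G.edgeCut A) (hfin X)
  have h5 := Set.ncard_inter_add_ncard_sdiff_eq_ncard (G.edgeCut A) (G.edgeCut X) (hfin A)
  rw [Set.inter_comm] at h4
  omega

end Graph

/-! ### Factors of bipartite graphs -/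

/-- The bound on the size of a cut in terms of its residue, for cuts directed to one side. -/
lemma circDist_two_mul_mul_add_le {k c D δ : ℤ} (hk : 0 < k) (hδ : δ = 1 ∨ δ = -1)
    (h1 : 5 * k - 1 ≤ D) (h2 : D ≤ 6 * k - 4) :
    2 * (2 * k) - 2 + circDist (2 * k) (2 * k * c - δ * D) ≤ D := by
  have hm : 0 < 2 * k := by omega
  -- For even `c` the residue is at distance at most `D - 4k`. For odd `c` it is represented by plus
  -- or minus `6k - D`, and `6k - D ≤ D - (4k - 2)` is exactly `D ≥ 5k - 1`.
  obtain ⟨r, hr, hd⟩ : ∃ r, 2 * (2 * k) ∣ (2 * k * c - δ * D) - r ∧ |r| ≤ D - (4 * k - 2) := by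
    rcases Int.even_or_odd' c with ⟨d, rfl | rfl⟩
    · refine ⟨-δ * (D - 4 * k), ⟨d - δ, by ring⟩, ?_⟩
      rw [abs_mul, abs_of_nonneg (a := D - 4 * k) (by omega)]
      rcases hδ with rfl | rfl <;> norm_num <;> omega
    · rcases hδ with rfl | rfl
      · refine ⟨6 * k - D, ⟨d - 1, by ring⟩, ?_⟩
        rw [abs_of_nonneg (by omega)]
        omega
      · refine ⟨D - 6 * k, ⟨d + 2, by ring⟩, ?_⟩
        rw [abs_of_nonpos (by omega)]
        omega
  rw [circDist_congr hr]
  have := circDist_le_abs hm r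
  omega

namespace Graph

variable {α β : Type*} {G : Graph α β}

theorem exists_factor_of_bipartite (hV : V(G).Finite) (hE : E(G).Finite)
    (hEven : Even V(G).ncard) {k : ℕ} (hk : 0 < k) (hbip : G.IsBipartite)
    (hcon : G.IsEdgeConnected (5 * k - 1)) (hess : G.IsEssentiallyEdgeConnected (6 * k - 3)) :
    ∃ H : Graph α β, H ≤s G ∧ H.IsModuloRegular k ∧ ∀ v ∈ V(H), ¬ 2 * k ∣ H.degree v := by
  classical
  rcases Set.eq_empty_or_nonempty V(G) with hempty | ⟨v0, hv0⟩
  · refine ⟨G, IsSpanningSubgraph.rfl, fun v hv ↦ ?_, fun v hv ↦ ?_⟩ <;> simp [hempty] at hv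
  obtain ⟨X, Y, hXY, hXYV, hlink⟩ := hbip
  have : Fintype E(G) := hE.fintype
  choose s hs t ht hst using fun e : E(G) ↦ hlink e e.2
  have hnotX : ∀ v ∈ Y, v ∉ X := fun v hv hv' ↦ Set.disjoint_left.1 hXY hv' hv
  have hne : ∀ e, s e ≠ t e := fun e h ↦ hnotX _ (ht e) (h ▸ hs e)
  set S : Finset α := hV.toFinset with hS
  let sgn : α → ℤ := fun v ↦ if v ∈ X then 1 else -1
  let Q : OrState α E(G) :=
    { S := S, s := s, t := t, o := fun _ ↦ 0, i := fun _ ↦ 0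
      -- The subtracted sum is the excess when every edge goes from `X` to `Y`; it makes excess
      -- minus requirement equal to `2 * sgn v * (deg v - k)`, where `deg` is the factor degree.
      b := fun v ↦ 2 * k * sgn v - ∑ e, incInd (s e) (t e) v }
  have hsgn : ∀ v, 2 ∣ sgn v - 1 := by
    intro v
    simp only [sgn]
    split_ifs <;> norm_num
  have hb : ∀ A : Finset α, ∑ v ∈ A, Q.b v = 2 * k * ∑ v ∈ A, sgn v -
      ∑ e, ((if s e ∈ A then 1 else 0) - (if t e ∈ A then 1 else 0)) := by
    intro A
    simp only [Q, Finset.sum_sub_distrib (f := fun v ↦ 2 * (k : ℤ) * sgn v)]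
    rw [Finset.sum_comm, ← Finset.mul_sum]
    simp_rw [sum_incInd]
  have hmemS : ∀ e, s e ∈ S ∧ t e ∈ S := by
    intro e
    simp only [hS, Set.Finite.mem_toFinset]
    exact ⟨(hst e).left_mem, (hst e).right_mem⟩
  have hcutQ : ∀ A : Finset α, Q.cut A = ((G.edgeCut A).ncard : ℤ) := by
    intro A
    have h1 : G.edgeCut A = Subtype.val ''
        (((Finset.univ : Finset E(G)).filter fun e ↦ ¬ (s e ∈ A ↔ t e ∈ A) : Finset E(G)) :
          Set E(G)) := by
      ext e
      simp only [Finset.coe_filter, Finset.mem_univ, true_and, Set.mem_image, Set.mem_ofPred_eq,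
        Subtype.exists, exists_and_right, exists_eq_right]
      constructor
      · intro he
        have heE := G.edgeCut_subset A he
        exact ⟨heE, by simpa using ((hst ⟨e, heE⟩).mem_edgeCut_iff A).1 he⟩
      · rintro ⟨heE, he⟩
        exact ((hst ⟨e, heE⟩).mem_edgeCut_iff A).2 (by simpa using he)
    rw [h1, Set.ncard_image_of_injective _ Subtype.val_injective, Set.ncard_coe_finset,
      Finset.card_filter]
    simp only [OrState.cut, Q, add_zero, Finset.sum_const_zero, sepInd, Nat.cast_sum, ite_not,
      Nat.cast_ite, Nat.cast_one, Nat.cast_zero]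
  have hm : (1 : ℤ) < 2 * k := by omega
  have hm0 : (0 : ℤ) < 2 * k := by omega
  have hgood : Q.Good (2 * k) v0 := by
    refine ⟨?_, fun e _ ↦ hmemS e, fun _ ↦ le_rfl, fun _ ↦ le_rfl, ?_, ?_, ?_, ?_⟩
    · have h1 : S.card = V(G).ncard := (Set.ncard_eq_toFinset_card _ hV).symm
      have h2 : 0 < S.card := Finset.card_pos.2 ⟨v0, by simpa [hS] using hv0⟩
      change 2 ≤ S.card
      rw [← h1] at hEven
      obtain ⟨n, hn⟩ := hEven
      omega
    · rw [hb]
      have h1 : ∑ e, ((if s e ∈ S then (1 : ℤ) else 0) - (if t e ∈ S then 1 else 0)) = 0 :=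
        Finset.sum_eq_zero fun e _ ↦ by simp [hmemS e]
      -- This is where the parity of the number of vertices provides a multiple of `4k` in the
      -- total.
      have h2 : (2 : ℤ) ∣ ∑ v ∈ S, sgn v := by
        have h3 : (2 : ℤ) ∣ ∑ v ∈ S, (sgn v - 1) := Finset.dvd_sum fun v _ ↦ hsgn v
        rw [Finset.sum_sub_distrib, Finset.sum_const, nsmul_one] at h3
        have h4 : S.card = V(G).ncard := (Set.ncard_eq_toFinset_card _ hV).symm
        rw [← h4] at hEven
        obtain ⟨n, hn⟩ := hEven
        omega
      obtain ⟨c, hc⟩ := h2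
      change _ ∣ ∑ v ∈ S, ((0 : ℤ) - 0) - (2 * k * ∑ v ∈ S, sgn v - _)
      rw [h1, hc]
      exact ⟨-c, by simp; ring⟩
    · intro v _
      simp only [OrState.exc, Q, one_mul]
      exact ⟨∑ e, incInd (s e) (t e) v - k * sgn v, by ring⟩
    · have := circDist_nonneg hm0 (∑ v ∈ S, Q.b v)
      change ∑ v ∈ S, ((0 : ℤ) + 0) ≤ 2 * (2 * k) - 2 + circDist (2 * k) (∑ v ∈ S, Q.b v)
      simp only [add_zero, Finset.sum_const_zero]
      omega
    · intro A hA hAne hAS _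
      have hAne' : (A : Set α).Nonempty := hAne
      have hAV : (A : Set α) ⊂ V(G) := by
        refine Set.ssubset_iff_subset_ne.2 ⟨fun v hv ↦ ?_, fun h' ↦ hAS ?_⟩
        · simpa [Q, hS] using hA hv
        · ext v
          have := Set.ext_iff.1 h' v
          simpa [Q, hS] using this
      have h1 := hcon A hAne' hAV
      have hD := hcutQ A
      have hw : Q.cut A = ∑ e, sepInd (s e) (t e) A := by simp [OrState.cut, Q]
      have hpar : (2 : ℤ) ∣ Q.cut A -
          ∑ e, ((if s e ∈ A then 1 else 0) - (if t e ∈ A then 1 else 0)) := by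
        rw [hw, ← Finset.sum_sub_distrib]
        refine Finset.dvd_sum fun e _ ↦ ?_
        simp only [sepInd]
        by_cases h : s e ∈ A <;> by_cases h' : t e ∈ A <;> simp [h, h']
      rw [hb]
      set w : ℤ := ∑ e, ((if s e ∈ A then 1 else 0) - (if t e ∈ A then 1 else 0)) with hwdef
      set c := ∑ v ∈ A, sgn v
      rcases Nat.lt_or_ge (G.edgeCut A).ncard (6 * k - 3) with h2 | h2
      · obtain ⟨z, hz, hzinc⟩ := hess A hAne' hAV h2
        have hends : ∀ e, sepInd (s e) (t e) A ≠ 0 → z = if z ∈ X then s e else t e := by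
          intro e he
          have he' : (e : β) ∈ G.edgeCut A := by
            rw [(hst e).mem_edgeCut_iff]
            intro h'
            exact he (if_pos (by simpa using h'))
          rcases (hzinc e he').eq_or_eq_of_isLink (hst e) with h' | h'
          · rw [if_pos (h' ▸ hs e), ← h']
          · rw [if_neg (h' ▸ hnotX _ (ht e)), ← h']
        -- All edges of the cut meet `z`, and by bipartiteness `z` is always their end in the same
        -- class, so in direction from `X` to `Y` they all leave `A` or all enter it.
        obtain ⟨δ, hδ, hwδ⟩ : ∃ δ : ℤ, (δ = 1 ∨ δ = -1) ∧ w = δ * Q.cut A := by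
          have key : ∀ δ : ℤ, (∀ e, sepInd (s e) (t e) A ≠ 0 →
              ((if s e ∈ A then 1 else 0) - (if t e ∈ A then 1 else 0) : ℤ) = δ) →
              w = δ * Q.cut A := by
            intro δ h
            rw [hw, hwdef, Finset.mul_sum]
            refine Finset.sum_congr rfl fun e _ ↦ ?_
            by_cases he : sepInd (s e) (t e) A = 0
            · rw [he, mul_zero]
              have : s e ∈ A ↔ t e ∈ A := by
                by_contra hcon
                simp [sepInd, hcon] at he
              simp [this]
            · rw [h e he]
              simp only [sepInd] at he ⊢
              split_ifs at he ⊢ <;> simp_all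
          by_cases hzX : z ∈ X <;> by_cases hzA : z ∈ A
          · refine ⟨1, Or.inl rfl, key 1 fun e he ↦ ?_⟩
            have h3 := hends e he
            rw [if_pos hzX] at h3
            have h4 : t e ∉ A := fun h4 ↦ he (by simp [sepInd, ← h3, hzA, h4])
            simp [← h3, hzA, h4]
          · refine ⟨-1, Or.inr rfl, key (-1) fun e he ↦ ?_⟩
            have h3 := hends e he
            rw [if_pos hzX] at h3
            have h4 : t e ∈ A := by
              by_contra h4
              exact he (by simp [sepInd, ← h3, hzA, h4])
            simp [← h3, hzA, h4]
          · refine ⟨-1, Or.inr rfl, key (-1) fun e he ↦ ?_⟩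
            have h3 := hends e he
            rw [if_neg hzX] at h3
            have h4 : s e ∉ A := fun h4 ↦ he (by simp [sepInd, ← h3, hzA, h4])
            simp [← h3, hzA, h4]
          · refine ⟨1, Or.inl rfl, key 1 fun e he ↦ ?_⟩
            have h3 := hends e he
            rw [if_neg hzX] at h3
            have h4 : s e ∈ A := by
              by_contra h4
              exact he (by simp [sepInd, ← h3, hzA, h4])
            simp [← h3, hzA, h4]
        rw [hwδ]
        exact circDist_two_mul_mul_add_le (by omega) hδ (by omega) (by omega)
      -- The bound is at most `6k - 2`. If the cut has `6k - 3` edges, parity makes the distance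
      -- odd, hence at most `2k - 1`.
      · have h3 := circDist_le hm0 (2 * k * c - w)
        have h4 := two_dvd_circDist_sub hm0 (2 * k * c - w)
        have h5 : (2 : ℤ) ∣ 2 * k * c := ⟨k * c, by ring⟩
        omega
  obtain ⟨σ, hσ, hsol⟩ := hgood.solvable hm
  set F : Set β := Subtype.val ''
    (((Finset.univ : Finset E(G)).filter fun e ↦ σ e = 1 : Finset E(G)) : Set E(G)) with hF
  have hloop : ∀ v, (G.restrict F).loopSet v = ∅ := by
    intro v
    refine Set.eq_empty_of_forall_notMem fun e he ↦ ?_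
    rw [mem_loopSet, restrict_isLoopAt] at he
    have heE := he.1.edge_mem
    have h1 := he.1.eq_of_inc (hst ⟨e, heE⟩).inc_left
    have h2 := he.1.eq_of_inc (hst ⟨e, heE⟩).inc_right
    exact hne ⟨e, heE⟩ (h1.symm.trans h2)
  have hdeg : ∀ v, 2 * ((G.restrict F).degree v : ℤ) * sgn v =
      ∑ e, (σ e + 1) * incInd (s e) (t e) v := by
    intro v
    have h1 : (G.restrict F).incidenceSet v = Subtype.val ''
        (((Finset.univ : Finset E(G)).filter fun e ↦ σ e = 1 ∧ (s e = v ∨ t e = v) :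
          Finset E(G)) : Set E(G)) := by
      ext e
      simp only [mem_incidenceSet, restrict_inc, hF, Finset.coe_filter, Finset.mem_univ, true_and,
        Set.mem_image, Set.mem_ofPred_eq, Subtype.exists, exists_and_right, exists_eq_right]
      constructor
      · rintro ⟨hinc, heE, he⟩
        refine ⟨heE, he, ?_⟩
        rcases hinc.eq_or_eq_of_isLink (hst ⟨e, heE⟩) with h | h
        exacts [Or.inl h.symm, Or.inr h.symm]
      · rintro ⟨heE, he, h | h⟩
        · exact ⟨h ▸ (hst ⟨e, heE⟩).inc_left, heE, he⟩
        · exact ⟨h ▸ (hst ⟨e, heE⟩).inc_right, heE, he⟩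
    rw [degree, hloop, Set.ncard_empty, add_zero, h1,
      Set.ncard_image_of_injective _ Subtype.val_injective, Set.ncard_coe_finset,
      Finset.card_filter, Nat.cast_sum, mul_assoc, Finset.sum_mul, Finset.mul_sum]
    refine Finset.sum_congr rfl fun e _ ↦ ?_
    have hsX := hs e
    have htX := hnotX _ (ht e)
    have hste := hne e
    rcases hσ e with h | h
    · by_cases h2 : s e = v
      · subst h2
        simp [incInd, h, hste.symm, sgn, hsX]
      · by_cases h3 : t e = v
        · subst h3
          simp [incInd, h, hste, sgn, htX]
        · simp [incInd, h, h2, h3]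
    · norm_num [h]
  have hmain : ∀ v ∈ V(G), ∃ c : ℤ, ((G.restrict F).degree v : ℤ) = k + 2 * k * c := by
    intro v hv
    have h1 := hsol v (by simpa [Q, hS] using hv)
    have h2 : Q.exc σ v - Q.b v = ∑ e, (σ e + 1) * incInd (s e) (t e) v - 2 * k * sgn v := by
      simp only [OrState.exc, Q, add_mul, one_mul, Finset.sum_add_distrib]
      ring
    rw [h2, ← hdeg] at h1
    obtain ⟨c, hc⟩ := h1
    have h3 : sgn v = 1 ∨ sgn v = -1 := by
      simp only [sgn]
      split_ifs <;> simp
    rcases h3 with h3 | h3 <;> rw [h3] at hc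
    · exact ⟨c, by linarith⟩
    · exact ⟨-c, by linarith⟩
  have hndvd : ∀ v ∈ V(G), ¬ 2 * k ∣ (G.restrict F).degree v := by
    rintro v hv ⟨d, hd⟩
    obtain ⟨c, hc⟩ := hmain v hv
    rw [hd] at hc
    push_cast at hc
    have hk' : (k : ℤ) ≠ 0 := by omega
    -- An odd multiple of `k` is not a multiple of `2k`; in particular it is nonzero, which gives
    -- positive degrees.
    have : (2 : ℤ) * d = 1 + 2 * c := mul_left_cancel₀ hk' (by linarith)
    omega
  refine ⟨G.restrict F, G.isSpanningSubgraph_restrict F, fun v hv ↦ ⟨?_, ?_⟩, hndvd⟩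
  · refine Nat.pos_of_ne_zero fun h0 ↦ hndvd v hv ?_
    rw [h0]
    exact dvd_zero _
  · obtain ⟨c, hc⟩ := hmain v hv
    exact Int.natCast_dvd_natCast.1 ⟨1 + 2 * c, by rw [hc]; ring⟩

end Graph

/-! ### Reduction of the general case to a maximum cut -/

theorem mainTheorem8 {α β : Type*} (G : Graph α β) (hV : V(G).Finite) (hE : E(G).Finite)
    (hEven : Even V(G).ncard) (k : ℕ) (hk : 0 < k) :
    (G.IsEdgeConnected (10 * k - 3) → G.IsEssentiallyEdgeConnected (12 * k - 7) →
      ∃ H : Graph α β, H ≤s G ∧ H.IsModuloRegular k ∧ ∀ v ∈ V(H), ¬ 2 * k ∣ H.degree v) ∧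
    (G.IsBipartite → G.IsEdgeConnected (5 * k - 1) → G.IsEssentiallyEdgeConnected (6 * k - 3) →
      ∃ H : Graph α β, H ≤s G ∧ H.IsModuloRegular k ∧ ∀ v ∈ V(H), ¬ 2 * k ∣ H.degree v) := by
  refine ⟨fun hcon hess ↦ ?_,
    fun hbip hcon hess ↦ Graph.exists_factor_of_bipartite hV hE hEven hk hbip hcon hess⟩
  obtain ⟨X, hX, hhalf⟩ := Graph.exists_edgeCut_half hV hE
  have hbip : (G.restrict (G.edgeCut X)).IsBipartite := by
    refine ⟨X, V(G) \ X, disjoint_sdiff_self_right, Set.union_sdiff_cancel hX, ?_⟩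
    rintro e ⟨-, he⟩
    obtain ⟨x, hx, y, hy, h⟩ := id he
    exact ⟨x, hx, y, ⟨h.right_mem, hy⟩, he, h⟩
  -- Half of `10k - 3`, rounded up, is `5k - 1`.
  have hcon' : (G.restrict (G.edgeCut X)).IsEdgeConnected (5 * k - 1) := by
    intro A hA hAV
    have h1 := hcon A hA hAV
    have h2 := hhalf A hAV.subset
    rw [Graph.edgeCut_restrict]
    omega
  have hess' : (G.restrict (G.edgeCut X)).IsEssentiallyEdgeConnected (6 * k - 3) := by
    intro A hA hAV hlt
    rw [Graph.edgeCut_restrict] at hlt ⊢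
    have h2 := hhalf A hAV.subset
    -- At most `6k - 4` edges kept means at most `12k - 8` edges in the cut of `G`.
    obtain ⟨v, hv, h⟩ := hess A hA hAV (by omega)
    exact ⟨v, hv, fun e he ↦ Graph.restrict_inc.2 ⟨h e he.1, he.2⟩⟩
  obtain ⟨H, hH, hreg⟩ :=
    Graph.exists_factor_of_bipartite (G := G.restrict (G.edgeCut X)) hV
    (hE.subset Set.inter_subset_left) hEven hk hbip hcon' hess'
  exact ⟨H, hH.trans (G.isSpanningSubgraph_restrict _), hreg⟩
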